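/- Let $d\in\mathbb{N}$, let $u_0\in H^1(\mathbb{R}^d)$ be real-valued and let $\xi\in C_c^\infty(\mathbb{R}^d;\mathbb{R}^d)$. Let $\{\boldsymbol{t}_t\}_{t\in\mathbb{R}}$ be the flow of $\xi$, i.e. $\partial_t\boldsymbol{t}_t=\xi\circ\boldsymbol{t}_t$ for all $t\in\mathbb{R}$ and $\boldsymbol{t}_0=\mathrm{id}$. For $t\in\mathbb{R}$ let $u_t=(\boldsymbol{t}_t)_\sharp u_0$ be the push-forward of $u_0$ (as a density with respect to Lebesgue measure) under $\boldsymbol{t}_t$, i.e. $u_t$ is the locally integrable function, unique up to null sets, with \[ \int_{\mathbb{R}^d}u_t\,\zeta\,dx=\int_{\mathbb{R}^d}u_0(x)\,\zeta(\boldsymbol{t}_t(x))\,dx\qquad\text{for all }\zeta\in C_c^0(\mathbb{R}^d). \] Then $u_t\in H^1(\mathbb{R}^d)$ for every $t\in\mathbb{R}$, the function $t\mapsto\int_{\mathbb{R}^d}\frac12|\nabla u_t|^2\,dx$ is differentiable at $t=0$, and \[ \frac{d}{dt}\bigg|_{t=0}\int_{\mathbb{R}^d}\frac12|\nabla u_t|^2\,dx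 =\int_{\mathbb{R}^d}\Big[-\nabla u_0\cdot\nabla\xi\,\nabla u_0-\frac12|\nabla u_0|^2\,\nabla\cdot\xi-u_0\nabla u_0\cdot\nabla(\nabla\cdot\xi)\Big]\,dx, \] where the integrand on the right is integrable. Here $\nabla u$ denotes the weak gradient of $u\in H^1(\mathbb{R}^d)$ and $\nabla\xi$ the Jacobian matrix of $\xi$. -/

import Mathlib

open MeasureTheory
open scoped ContDiff

noncomputable section

namespace DirichletVariation

/-- `ℝᵈ` with its Euclidean norm. -/
abbrev Space (d : ℕ) : Type := EuclideanSpace ℝ (Fin d)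

/-- The `i`-th standard basis vector of `ℝᵈ`. -/
def stdVec {d : ℕ} (i : Fin d) : Space d := EuclideanSpace.single i (1 : ℝ)

/-- The locally integrable vector field `g` is a weak gradient of the locally integrable
function `u`: `∫ u ∂ᵢφ = - ∫ gᵢ φ` for all `φ ∈ C_c^∞(ℝᵈ)` and all `i`. -/
def IsWeakGradient {d : ℕ} (u : Space d → ℝ) (g : Space d → Space d) : Prop :=
  LocallyIntegrable u ∧ LocallyIntegrable g ∧
    ∀ φ : Space d → ℝ, ContDiff ℝ ∞ φ → HasCompactSupport φ → ∀ i : Fin d,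
      ∫ x, u x * fderiv ℝ φ x (stdVec i) = - ∫ x, g x i * φ x

/-- `u ∈ H¹(ℝᵈ)`: `u ∈ L²` and `u` has a weak gradient in `L²`. -/
def MemH1 {d : ℕ} (u : Space d → ℝ) : Prop :=
  MemLp u 2 ∧ ∃ g : Space d → Space d, MemLp g 2 ∧ IsWeakGradient u g

open Classical in
/-- The weak gradient `∇u` (unique up to null sets); `0` if `u` has none. -/
def weakGrad {d : ℕ} (u : Space d → ℝ) : Space d → Space d :=
  if h : ∃ g : Space d → Space d, IsWeakGradient u g then h.choose else 0

/-- The Dirichlet energy `∫ ½ |∇u|² dx`. -/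
def dirichletEnergy {d : ℕ} (u : Space d → ℝ) : ℝ :=
  ∫ x, (1 / 2 : ℝ) * ‖weakGrad u x‖ ^ 2

/-- The divergence `∇ · ξ = ∑ᵢ ∂ᵢ ξᵢ`. -/
def divergence {d : ℕ} (ξ : Space d → Space d) (x : Space d) : ℝ :=
  ∑ i : Fin d, fderiv ℝ ξ x (stdVec i) i

/-- `T` is the flow of `ξ`: `∂ₜ Tₜ = ξ ∘ Tₜ` for all `t ∈ ℝ`, and `T₀ = id`. -/
def IsFlow {d : ℕ} (ξ : Space d → Space d) (T : ℝ → Space d → Space d) : Prop :=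
  (∀ x, T 0 x = x) ∧ ∀ t x, HasDerivAt (fun s => T s x) (ξ (T t x)) t

/-- The locally integrable function `v` is the push-forward `S_♯ u` (of `u` as a density with
respect to Lebesgue measure): `∫ v ζ = ∫ u (ζ ∘ S)` for all `ζ ∈ C_c⁰(ℝᵈ)`. -/
def IsPushforward {d : ℕ} (S : Space d → Space d) (u v : Space d → ℝ) : Prop :=
  LocallyIntegrable v ∧
    ∀ ζ : Space d → ℝ, Continuous ζ → HasCompactSupport ζ →
      ∫ x, v x * ζ x = ∫ x, u x * ζ (S x)

/-- The integrand
`-∇u · ∇ξ ∇u - ½ |∇u|² ∇·ξ - u ∇u · ∇(∇·ξ)`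
of the first variation of the Dirichlet energy. -/
def variationIntegrand {d : ℕ} (u : Space d → ℝ) (ξ : Space d → Space d) (x : Space d) : ℝ :=
  - inner ℝ (weakGrad u x) (fderiv ℝ ξ x (weakGrad u x))
    - (1 / 2 : ℝ) * ‖weakGrad u x‖ ^ 2 * divergence ξ x
    - u x * inner ℝ (weakGrad u x) (gradient (divergence ξ) x)

end DirichletVariation

end

/-!
The push-forward `uₜ` satisfies `uₜ ∘ Tₜ = u₀ exp (-ℓₜ)`, where Liouville's formula identifies the
logarithm of the Jacobian determinant as `ℓₜ = ∫₀ᵗ (∇ · ξ) ∘ Tₛ ds`. Hence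
`∇uₜ ∘ Tₜ = exp (-ℓₜ) pₜ` with `pₜ = (DTₜ)⁻ᵀ (∇u₀ - u₀ ∇ℓₜ)`, and the change of variables
`x = Tₜ y` removes every derivative of `u₀` from the time dependence:
`∫ ½ |∇uₜ|² = ∫ ½ exp (-ℓₜ) |pₜ|²`. From the linearized flow equation one reads off
`∂ₜ pₜ = -(Dξ ∘ Tₜ)ᵀ pₜ - u₀ ∇(∇ · ξ) ∘ Tₜ`, and all terms are dominated by squares of `|∇u₀|` and
`|u₀|`, so one may differentiate under the integral.

For a merely weakly differentiable `u₀` the formula for `∇uₜ` is tested against a smooth `φ`: the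
vector field `(φ ∘ Tₜ) (DTₜ)⁻¹ e` is only `C⁰`, but it has the weak divergence
`(∂ₑφ) ∘ Tₜ - (φ ∘ Tₜ) Dℓₜ ((DTₜ)⁻¹ e)`, and mollification shows that weak gradients may be paired
with such fields.
-/

/-! ### Flows of Lipschitz vector fields -/

namespace DirichletVariation

section Gronwall

variable {F : Type*} [NormedAddCommGroup F] [NormedSpace ℝ F]

theorem norm_le_gronwallBound_abs {f f' : ℝ → F} {a K ε δ : ℝ}
    (hf : ∀ t, |t| < δ → HasDerivAt f (f' t) t) (h0 : ‖f 0‖ ≤ a)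
    (hb : ∀ t, |t| < δ → ‖f' t‖ ≤ K * ‖f t‖ + ε) {t : ℝ} (ht : |t| < δ) :
    ‖f t‖ ≤ gronwallBound a K ε |t| := by
  have forward : ∀ g g' : ℝ → F, (∀ s, |s| < δ → HasDerivAt g (g' s) s) → ‖g 0‖ ≤ a →
      (∀ s, |s| < δ → ‖g' s‖ ≤ K * ‖g s‖ + ε) → ‖g |t|‖ ≤ gronwallBound a K ε |t| := by
    intro g g' hg hg0 hgb
    have habs : ∀ s ∈ Set.Icc 0 |t|, |s| < δ := fun s hs => by
      rw [abs_of_nonneg hs.1]; exact hs.2.trans_lt ht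
    simpa using norm_le_gronwallBound_of_norm_deriv_right_le (f := g) (f' := g') (a := 0)
      (fun s hs => (hg s (habs s hs)).continuousAt.continuousWithinAt)
      (fun s hs => (hg s (habs s ⟨hs.1, hs.2.le⟩)).hasDerivWithinAt) hg0
      (fun s hs => hgb s (habs s ⟨hs.1, hs.2.le⟩)) |t| ⟨abs_nonneg t, le_rfl⟩
  rcases abs_choice t with h | h
  · simpa only [h] using forward f f' hf h0 hb
  · have hf_neg : ∀ s, |s| < δ → HasDerivAt (fun s => f (-s)) (-f' (-s)) s := fun s hs => by
      simpa [Function.comp_def] using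
        (hf (-s) (by rwa [abs_neg])).scomp s (hasDerivAt_neg s)
    simpa [h] using forward (fun s => f (-s)) (fun s => -f' (-s)) hf_neg (by simpa using h0)
      (fun s hs => by simpa using hb (-s) (by rwa [abs_neg]))

theorem norm_le_exp_mul_of_norm_deriv_le {f f' : ℝ → F} {a K δ : ℝ}
    (hf : ∀ t, |t| < δ → HasDerivAt f (f' t) t) (h0 : ‖f 0‖ ≤ a)
    (hb : ∀ t, |t| < δ → ‖f' t‖ ≤ K * ‖f t‖) {t : ℝ} (ht : |t| < δ) :
    ‖f t‖ ≤ Real.exp (K * |t|) * a := by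
  simpa only [gronwallBound_ε0, mul_comm] using
    norm_le_gronwallBound_abs hf h0 (ε := 0) (by simpa using hb) ht

theorem norm_le_mul_gronwallBound {f f' : ℝ → F} {K ε δ : ℝ}
    (hf : ∀ t, |t| < δ → HasDerivAt f (f' t) t) (h0 : f 0 = 0)
    (hb : ∀ t, |t| < δ → ‖f' t‖ ≤ K * ‖f t‖ + ε) {t : ℝ} (ht : |t| < δ) :
    ‖f t‖ ≤ ε * gronwallBound 0 K 1 |t| := by
  have scaling : gronwallBound 0 K ε |t| = ε * gronwallBound 0 K 1 |t| := by
    by_cases hK : K = 0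
    · simp [gronwallBound, hK]
    · simp only [gronwallBound, if_neg hK]
      ring
  exact (norm_le_gronwallBound_abs hf (by simp [h0]) hb ht).trans_eq scaling

end Gronwall

theorem norm_sub_sub_fderiv_le {E F : Type*} [NormedAddCommGroup E] [NormedSpace ℝ E]
    [NormedAddCommGroup F] [NormedSpace ℝ F] {f : E → F} {M : NNReal}
    (hf : Differentiable ℝ f) (hM : LipschitzWith M (fderiv ℝ f)) (x y : E) :
    ‖f y - f x - fderiv ℝ f x (y - x)‖ ≤ M * ‖y - x‖ ^ 2 := by
  have fderiv_sub_le : ∀ z ∈ segment ℝ x y, ‖fderiv ℝ f z - fderiv ℝ f x‖ ≤ M * ‖y - x‖ := by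
    intro z hz
    refine (hM.norm_sub_le z x).trans ?_
    gcongr
    exact norm_sub_le_of_mem_segment hz
  rw [pow_two, ← mul_assoc]
  exact (convex_segment x y).norm_image_sub_le_of_norm_hasFDerivWithin_le'
    (fun z _ => (hf z).hasFDerivAt.hasFDerivWithinAt) fderiv_sub_le
    (left_mem_segment ℝ x y) (right_mem_segment ℝ x y)

variable {E : Type*} [NormedAddCommGroup E] [NormedSpace ℝ E]

/-- `T` is the flow, defined for all times, of the vector field `ξ` on a normed space. -/
def IsGlobalFlow (ξ : E → E) (T : ℝ → E → E) : Prop :=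
  (∀ x, T 0 x = x) ∧ ∀ t x, HasDerivAt (fun s => T s x) (ξ (T t x)) t

/-- `A` solves, for times `|t| < δ`, the equation of variations `A' = Dξ(Tₜ x) A`, `A 0 = id`,
of the flow `T` of `ξ` along the trajectory of `x`. -/
def IsLinearization (ξ : E → E) (T : ℝ → E → E) (δ : ℝ) (x : E) (A : ℝ → E →L[ℝ] E) : Prop :=
  A 0 = ContinuousLinearMap.id ℝ E ∧
    ∀ t, |t| < δ → HasDerivAt A (fderiv ℝ ξ (T t x) ∘L A t) t

variable {ξ : E → E} {T : ℝ → E → E} {K M : NNReal} {δ t : ℝ} {x y : E}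
  {A B : ℝ → E →L[ℝ] E}

theorem IsLinearization.norm_le (hA : IsLinearization ξ T δ x A) (hK : LipschitzWith K ξ)
    (ht : |t| < δ) : ‖A t‖ ≤ Real.exp (K * δ) := by
  have h := norm_le_exp_mul_of_norm_deriv_le (a := 1) hA.2
    (hA.1 ▸ ContinuousLinearMap.norm_id_le)
    (fun s _ => (ContinuousLinearMap.opNorm_comp_le _ _).trans
      (by gcongr; exact norm_fderiv_le_of_lipschitz ℝ hK)) ht
  exact h.trans (by rw [mul_one]; gcongr)

namespace IsGlobalFlow

theorem continuous_time (hT : IsGlobalFlow ξ T) (x : E) : Continuous fun t => T t x :=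
  continuous_iff_continuousAt.2 fun t => (hT.2 t x).continuousAt

theorem apply_add (hT : IsGlobalFlow ξ T) (hK : LipschitzWith K ξ) (s t : ℝ) (x : E) :
    T (s + t) x = T s (T t x) := by
  have h := ODE_solution_unique_univ (v := fun _ => ξ) (s := fun _ => Set.univ) (K := K)
    (f := fun r => T (r + t) x) (g := fun r => T r (T t x)) (t₀ := 0)
    (fun _ => hK.lipschitzOnWith)
    (fun r => ⟨by simpa using (hT.2 (r + t) x).comp_add_const r t, trivial⟩)
    (fun r => ⟨hT.2 r (T t x), trivial⟩) (by simp [hT.1])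
  exact congrFun h s

theorem norm_sub_le (hT : IsGlobalFlow ξ T) (hK : LipschitzWith K ξ) (t : ℝ) (x y : E) :
    ‖T t x - T t y‖ ≤ Real.exp (K * |t|) * ‖x - y‖ :=
  norm_le_exp_mul_of_norm_deriv_le (f := fun s => T s x - T s y)
    (fun s _ => (hT.2 s x).sub (hT.2 s y)) (by simp [hT.1])
    (fun s _ => hK.norm_sub_le (T s x) (T s y)) (lt_add_one |t|)

theorem lipschitzWith (hT : IsGlobalFlow ξ T) (hK : LipschitzWith K ξ) (t : ℝ) :
    LipschitzWith (Real.exp (K * |t|)).toNNReal (T t) :=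
  LipschitzWith.of_dist_le' fun x y => by
    simpa only [dist_eq_norm] using hT.norm_sub_le hK t x y

theorem norm_fderiv_le (hT : IsGlobalFlow ξ T) (hK : LipschitzWith K ξ) (t : ℝ) (x : E) :
    ‖fderiv ℝ (T t) x‖ ≤ Real.exp (K * |t|) := by
  simpa only [Real.coe_toNNReal _ (Real.exp_pos _).le] using
    norm_fderiv_le_of_lipschitz ℝ (hT.lipschitzWith hK t) (x₀ := x)

/-- The time-`t` map of a flow, as a homeomorphism with inverse the time-`-t` map. -/
def homeomorph (hT : IsGlobalFlow ξ T) (hK : LipschitzWith K ξ) (t : ℝ) : E ≃ₜ E where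
  toFun := T t
  invFun := T (-t)
  left_inv x := by rw [← hT.apply_add hK, neg_add_cancel, hT.1]
  right_inv x := by rw [← hT.apply_add hK, add_neg_cancel, hT.1]
  continuous_toFun := (hT.lipschitzWith hK t).continuous
  continuous_invFun := (hT.lipschitzWith hK (-t)).continuous

theorem exists_isLinearization [CompleteSpace E] (hT : IsGlobalFlow ξ T) (hξ : ContDiff ℝ 1 ξ)
    (hK : LipschitzWith K ξ) (hδ : 0 < δ) (hKδ : K * 2 * δ ≤ 1) (x : E) :
    ∃ A, IsLinearization ξ T δ x A := by
  have norm_fderiv_le : ∀ y, ‖fderiv ℝ ξ y‖ ≤ K := fun y => norm_fderiv_le_of_lipschitz ℝ hK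
  have isPicardLindelof : IsPicardLindelof
      (fun t (Y : E →L[ℝ] E) => fderiv ℝ ξ (T t x) ∘L Y) (tmin := -δ) (tmax := δ)
      ⟨0, by linarith, hδ.le⟩ (ContinuousLinearMap.id ℝ E) 1 0 (K * 2) K := by
    refine ⟨fun t _ => LipschitzWith.lipschitzOnWith ?_, fun Y _ => ?_, fun t _ Y hY => ?_, ?_⟩
    · refine LipschitzWith.of_dist_le_mul fun Y Z => ?_
      rw [dist_eq_norm, dist_eq_norm, ← ContinuousLinearMap.comp_sub]
      exact (ContinuousLinearMap.opNorm_comp_le _ _).trans (by gcongr; exact norm_fderiv_le _)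
    · have : Continuous fun t => fderiv ℝ ξ (T t x) :=
        (hξ.continuous_fderiv one_ne_zero).comp (hT.continuous_time x)
      exact (this.clm_comp continuous_const).continuousOn
    · have norm_Y_le : ‖Y‖ ≤ 2 := by
        have hY1 : ‖Y - ContinuousLinearMap.id ℝ E‖ ≤ 1 := mem_closedBall_iff_norm.1 hY
        have hid : ‖ContinuousLinearMap.id ℝ E‖ ≤ 1 := ContinuousLinearMap.norm_id_le
        linarith [norm_le_norm_add_norm_sub' Y (ContinuousLinearMap.id ℝ E)]
      exact (ContinuousLinearMap.opNorm_comp_le _ _).trans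
        (mul_le_mul (norm_fderiv_le _) norm_Y_le (norm_nonneg _) K.2)
    · simpa using hKδ
  obtain ⟨A, hA0, hA⟩ := isPicardLindelof.exists_eq_forall_mem_Icc_hasDerivWithinAt₀
  refine ⟨A, hA0, fun t ht => ?_⟩
  obtain ⟨h1, h2⟩ := abs_lt.1 ht
  exact (hA t ⟨h1.le, h2.le⟩).hasDerivAt (Icc_mem_nhds h1 h2)

theorem norm_sub_le_of_abs_lt (hT : IsGlobalFlow ξ T) (hK : LipschitzWith K ξ) (ht : |t| < δ)
    (x y : E) : ‖T t x - T t y‖ ≤ Real.exp (K * δ) * ‖x - y‖ :=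
  (hT.norm_sub_le hK t x y).trans (by gcongr)

theorem norm_sub_sub_linearization_le (hT : IsGlobalFlow ξ T) (hξ : Differentiable ℝ ξ)
    (hK : LipschitzWith K ξ) (hM : LipschitzWith M (fderiv ℝ ξ))
    (hA : IsLinearization ξ T δ x A) (ht : |t| < δ) :
    ‖T t y - T t x - A t (y - x)‖ ≤
      M * (Real.exp (K * δ) * ‖y - x‖) ^ 2 * gronwallBound 0 K 1 |t| := by
  refine norm_le_mul_gronwallBound (f := fun s => T s y - T s x - A s (y - x))
    (f' := fun s => ξ (T s y) - ξ (T s x) - (fderiv ℝ ξ (T s x) ∘L A s) (y - x))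
    (fun s hs => ((hT.2 s y).sub (hT.2 s x)).sub (by
      simpa only [map_zero, add_zero] using (hA.2 s hs).clm_apply (hasDerivAt_const s (y - x))))
    (by simp [hT.1, hA.1]) (fun s hs => ?_) ht
  have splitting : ξ (T s y) - ξ (T s x) - (fderiv ℝ ξ (T s x) ∘L A s) (y - x) =
      fderiv ℝ ξ (T s x) (T s y - T s x - A s (y - x)) +
        (ξ (T s y) - ξ (T s x) - fderiv ℝ ξ (T s x) (T s y - T s x)) := by
    simp only [map_sub, ContinuousLinearMap.comp_apply]
    abel
  rw [splitting]
  refine (norm_add_le _ _).trans (add_le_add ?_ ?_)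
  · exact ContinuousLinearMap.le_of_opNorm_le _ (norm_fderiv_le_of_lipschitz ℝ hK) _
  · refine (norm_sub_sub_fderiv_le hξ hM _ _).trans ?_
    gcongr
    exact hT.norm_sub_le_of_abs_lt hK hs y x

theorem norm_linearization_sub_le (hT : IsGlobalFlow ξ T) (hK : LipschitzWith K ξ)
    (hM : LipschitzWith M (fderiv ℝ ξ)) (hA : IsLinearization ξ T δ x A)
    (hB : IsLinearization ξ T δ y B) (ht : |t| < δ) :
    ‖A t - B t‖ ≤
      M * (Real.exp (K * δ) * ‖x - y‖) * Real.exp (K * δ) * gronwallBound 0 K 1 |t| := by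
  refine norm_le_mul_gronwallBound (f := fun s => A s - B s)
    (fun s hs => (hA.2 s hs).sub (hB.2 s hs)) (by simp [hA.1, hB.1]) (fun s hs => ?_) ht
  have splitting : fderiv ℝ ξ (T s x) ∘L A s - fderiv ℝ ξ (T s y) ∘L B s =
      fderiv ℝ ξ (T s x) ∘L (A s - B s) + (fderiv ℝ ξ (T s x) - fderiv ℝ ξ (T s y)) ∘L B s := by
    rw [ContinuousLinearMap.comp_sub, ContinuousLinearMap.sub_comp]
    abel
  rw [splitting]
  refine (norm_add_le _ _).trans (add_le_add ?_ ?_) <;>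
    refine (ContinuousLinearMap.opNorm_comp_le _ _).trans ?_
  · gcongr
    exact norm_fderiv_le_of_lipschitz ℝ hK
  · refine mul_le_mul ?_ (hB.norm_le hK hs) (norm_nonneg _) (by positivity)
    refine (hM.norm_sub_le _ _).trans ?_
    gcongr
    exact hT.norm_sub_le_of_abs_lt hK hs x y

theorem hasFDerivAt_of_isLinearization (hT : IsGlobalFlow ξ T) (hξ : Differentiable ℝ ξ)
    (hK : LipschitzWith K ξ) (hM : LipschitzWith M (fderiv ℝ ξ))
    (hA : IsLinearization ξ T δ x A) (ht : |t| < δ) : HasFDerivAt (T t) (A t) x := by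
  rw [hasFDerivAt_iff_isLittleO_nhds_zero]
  refine Asymptotics.IsBigO.trans_isLittleO (g := fun h : E => ‖h‖ ^ 2) ?_
    (Asymptotics.isLittleO_norm_pow_id one_lt_two)
  refine Asymptotics.IsBigO.of_bound (M * Real.exp (K * δ) ^ 2 * gronwallBound 0 K 1 |t|)
    (Filter.Eventually.of_forall fun h => ?_)
  have remainder := hT.norm_sub_sub_linearization_le hξ hK hM hA (y := x + h) ht
  rw [add_sub_cancel_left] at remainder
  refine remainder.trans_eq ?_
  rw [norm_pow, norm_norm]
  ring

variable [CompleteSpace E]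

theorem exists_contDiff_of_abs_lt (hT : IsGlobalFlow ξ T) (hξ : ContDiff ℝ 1 ξ)
    (hK : LipschitzWith K ξ) (hM : LipschitzWith M (fderiv ℝ ξ)) :
    ∃ δ > 0, (∀ t, |t| < δ → ContDiff ℝ 1 (T t)) ∧
      ∀ x, HasDerivAt (fun t => fderiv ℝ (T t) x) (fderiv ℝ ξ x) 0 := by
  obtain ⟨δ, hδ, hKδ⟩ : ∃ δ : ℝ, 0 < δ ∧ K * 2 * δ ≤ 1 := by
    refine ⟨1 / (K * 2 + 1), by positivity, ?_⟩
    rw [mul_one_div, div_le_one (by positivity)]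
    linarith
  choose A hA using fun x => hT.exists_isLinearization hξ hK hδ hKδ x
  have hasFDerivAt : ∀ x t, |t| < δ → HasFDerivAt (T t) (A x t) x := fun x _ ht =>
    hT.hasFDerivAt_of_isLinearization (hξ.differentiable one_ne_zero) hK hM (hA x) ht
  refine ⟨δ, hδ, fun t ht => contDiff_one_iff_fderiv.2
    ⟨fun x => (hasFDerivAt x t ht).differentiableAt, ?_⟩, fun x => ?_⟩
  · rw [funext fun x => (hasFDerivAt x t ht).fderiv]
    refine (LipschitzWith.of_dist_le' (K := M * Real.exp (K * δ) * Real.exp (K * δ) *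
      gronwallBound 0 K 1 |t|) fun x y => ?_).continuous
    rw [dist_eq_norm, dist_eq_norm]
    exact (hT.norm_linearization_sub_le hK hM (hA x) (hA y) ht).trans_eq (by ring)
  · have h := (hA x).2 0 (by rwa [abs_zero])
    rw [(hA x).1, hT.1, ContinuousLinearMap.comp_id] at h
    refine h.congr_of_eventuallyEq ?_
    filter_upwards [Metric.ball_mem_nhds (0 : ℝ) hδ] with t ht
    exact (hasFDerivAt x t (by simpa using ht)).fderiv

theorem contDiff (hT : IsGlobalFlow ξ T) (hξ : ContDiff ℝ 1 ξ) (hK : LipschitzWith K ξ)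
    (hM : LipschitzWith M (fderiv ℝ ξ)) (t : ℝ) : ContDiff ℝ 1 (T t) := by
  obtain ⟨δ, hδ, small, -⟩ := hT.exists_contDiff_of_abs_lt hξ hK hM
  have doubling : ∀ n : ℕ, ∀ t, |t| < 2 ^ n * δ → ContDiff ℝ 1 (T t) := by
    intro n
    induction n with
    | zero => exact fun t ht => small t (by simpa using ht)
    | succ n ih =>
      intro t ht
      have half : ContDiff ℝ 1 (T (t / 2)) :=
        ih (t / 2) (by rw [abs_div, abs_two]; rw [pow_succ] at ht; linarith)
      have : T t = T (t / 2) ∘ T (t / 2) := funext fun x => by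
        rw [Function.comp_apply, ← hT.apply_add hK, add_halves]
      rw [this]
      exact half.comp half
  obtain ⟨n, hn⟩ := pow_unbounded_of_one_lt (|t| / δ) one_lt_two
  exact doubling n t (by rwa [div_lt_iff₀ hδ] at hn)

theorem fderiv_add (hT : IsGlobalFlow ξ T) (hξ : ContDiff ℝ 1 ξ) (hK : LipschitzWith K ξ)
    (hM : LipschitzWith M (fderiv ℝ ξ)) (s t : ℝ) (x : E) :
    fderiv ℝ (T (s + t)) x = fderiv ℝ (T s) (T t x) ∘L fderiv ℝ (T t) x := by
  have differentiable : ∀ r, Differentiable ℝ (T r) := fun r =>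
    (hT.contDiff hξ hK hM r).differentiable one_ne_zero
  rw [← fderiv_comp x (differentiable s _) (differentiable t _)]
  exact congrArg (fderiv ℝ · x) (funext fun y => hT.apply_add hK s t y)

theorem hasDerivAt_fderiv (hT : IsGlobalFlow ξ T) (hξ : ContDiff ℝ 1 ξ) (hK : LipschitzWith K ξ)
    (hM : LipschitzWith M (fderiv ℝ ξ)) (t : ℝ) (x : E) :
    HasDerivAt (fun t => fderiv ℝ (T t) x) (fderiv ℝ ξ (T t x) ∘L fderiv ℝ (T t) x) t := by
  obtain ⟨-, -, -, derivAt_zero⟩ := hT.exists_contDiff_of_abs_lt hξ hK hM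
  have factor : (fun s => fderiv ℝ (T s) x) =
      fun s => fderiv ℝ (T (s - t)) (T t x) ∘L fderiv ℝ (T t) x := funext fun s => by
    rw [← hT.fderiv_add hξ hK hM, sub_add_cancel]
  have shifted : HasDerivAt (fun s => fderiv ℝ (T (s - t)) (T t x)) (fderiv ℝ ξ (T t x)) t :=
    HasDerivAt.comp_sub_const (f := fun s => fderiv ℝ (T s) (T t x)) t t
      (by simpa only [sub_self] using derivAt_zero (T t x))
  rw [factor]
  simpa using shifted.clm_comp (hasDerivAt_const t (fderiv ℝ (T t) x))

end IsGlobalFlow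

end DirichletVariation

/-! ### The Jacobian determinant of a flow -/

namespace DirichletVariation

section Determinant

theorem hasDerivAt_matrix_det_of_eq_one {n : Type*} [Fintype n] [DecidableEq n]
    {A : ℝ → Matrix n n ℝ} {A' : Matrix n n ℝ} {t : ℝ} (hA1 : A t = 1)
    (hA : ∀ i j, HasDerivAt (fun s => A s i j) (A' i j) t) :
    HasDerivAt (fun s => (A s).det) A'.trace t := by
  let D : ContinuousMultilinearMap ℝ (fun _ : n => n → ℝ) ℝ :=
    { toMultilinearMap := (Matrix.detRowAlternating (R := ℝ) (n := n)).toMultilinearMap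
      cont := Continuous.matrix_det (A := fun M : Matrix n n ℝ => M) continuous_id }
  have rows : HasDerivAt (fun s => (fun i j => A s i j : n → n → ℝ)) (fun i j => A' i j) t :=
    hasDerivAt_pi.2 fun i => hasDerivAt_pi.2 fun j => hA i j
  refine ((D.hasFDerivAt (fun i j => A t i j)).comp_hasDerivAt t rows).congr_deriv ?_
  rw [ContinuousMultilinearMap.linearDeriv_apply, Matrix.trace]
  refine Finset.sum_congr rfl fun i _ => ?_
  change ((A t).updateRow i (A' i)).det = A' i i
  rw [hA1, ← Matrix.cramer_transpose_apply, Matrix.transpose_one, Matrix.cramer_one]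
  rfl

variable {E : Type*} [NormedAddCommGroup E] [NormedSpace ℝ E] [FiniteDimensional ℝ E]

theorem hasDerivAt_det_of_eq_id {A : ℝ → E →L[ℝ] E} {A' : E →L[ℝ] E} {t : ℝ}
    (hA1 : A t = ContinuousLinearMap.id ℝ E) (hA : HasDerivAt A A' t) :
    HasDerivAt (fun s => (A s).det) (LinearMap.trace ℝ E A') t := by
  let b := Module.finBasis ℝ E
  have det_eq : ∀ s, (A s).det = (LinearMap.toMatrix b b (A s)).det := fun s =>
    (LinearMap.det_toMatrix b _).symm
  have entries : ∀ i j, HasDerivAt (fun s => LinearMap.toMatrix b b (A s) i j)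
      (LinearMap.toMatrix b b A' i j) t := fun i j => by
    simp only [LinearMap.toMatrix_apply]
    exact (b.coord i).toContinuousLinearMap.hasFDerivAt.comp_hasDerivAt t
      (by simpa using hA.clm_apply (hasDerivAt_const t (b j)))
  simp only [det_eq, LinearMap.trace_eq_matrix_trace ℝ b]
  exact hasDerivAt_matrix_det_of_eq_one (by rw [hA1]; exact LinearMap.toMatrix_id b) entries

end Determinant

section TrajectoryIntegral

variable {α F : Type*} [NormedAddCommGroup F] [NormedSpace ℝ F]

/-- The integral of `f` along the trajectory of `x` under `T`, up to time `t`. For `f = ∇ · ξ`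
it is the logarithm of the Jacobian determinant of the flow of `ξ`. -/
noncomputable def trajectoryIntegral (T : ℝ → α → α) (f : α → F) (t : ℝ) (x : α) : F :=
  ∫ s in (0 : ℝ)..t, f (T s x)

theorem trajectoryIntegral_zero (T : ℝ → α → α) (f : α → F) (x : α) :
    trajectoryIntegral T f 0 x = 0 :=
  intervalIntegral.integral_same

theorem norm_trajectoryIntegral_le {f : α → F} {C : ℝ} (T : ℝ → α → α) (hf : ∀ x, ‖f x‖ ≤ C)
    (t : ℝ) (x : α) : ‖trajectoryIntegral T f t x‖ ≤ C * |t| :=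
  (intervalIntegral.norm_integral_le_of_norm_le_const fun s _ => hf (T s x)).trans_eq
    (by rw [sub_zero])

end TrajectoryIntegral

variable {E F : Type*} [NormedAddCommGroup E] [NormedSpace ℝ E] [NormedAddCommGroup F]
  [NormedSpace ℝ F] {ξ : E → E} {T : ℝ → E → E} {f : E → F} {K L M : NNReal}

namespace IsGlobalFlow

theorem hasDerivAt_trajectoryIntegral [CompleteSpace F] (hT : IsGlobalFlow ξ T)
    (hf : Continuous f) (t : ℝ) (x : E) :
    HasDerivAt (fun s => trajectoryIntegral T f s x) (f (T t x)) t :=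
  ((hf.comp (hT.continuous_time x)).integral_hasStrictDerivAt 0 t).hasDerivAt

theorem norm_fderiv_comp_fderiv_le (hT : IsGlobalFlow ξ T) (hK : LipschitzWith K ξ)
    (hL : LipschitzWith L f) {s t : ℝ} (hs : s ∈ Set.uIoc 0 t) (x : E) :
    ‖fderiv ℝ f (T s x) ∘L fderiv ℝ (T s) x‖ ≤ L * Real.exp (K * |t|) := by
  have hst : |s| ≤ |t| := by
    simpa using Set.abs_sub_left_of_mem_uIcc (Set.uIoc_subset_uIcc hs)
  refine (ContinuousLinearMap.opNorm_comp_le _ _).trans (mul_le_mul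
    (norm_fderiv_le_of_lipschitz ℝ hL) ((hT.norm_fderiv_le hK s x).trans ?_)
    (norm_nonneg _) L.2)
  gcongr

variable [CompleteSpace E]

theorem continuous_fderiv_time (hT : IsGlobalFlow ξ T) (hξ : ContDiff ℝ 1 ξ)
    (hK : LipschitzWith K ξ) (hM : LipschitzWith M (fderiv ℝ ξ)) (x : E) :
    Continuous fun s => fderiv ℝ (T s) x :=
  continuous_iff_continuousAt.2 fun t => (hT.hasDerivAt_fderiv hξ hK hM t x).continuousAt

theorem continuous_fderiv_comp_fderiv_time (hT : IsGlobalFlow ξ T) (hξ : ContDiff ℝ 1 ξ)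
    (hK : LipschitzWith K ξ) (hM : LipschitzWith M (fderiv ℝ ξ)) (hf : ContDiff ℝ 1 f) (x : E) :
    Continuous fun s => fderiv ℝ f (T s x) ∘L fderiv ℝ (T s) x :=
  ((hf.continuous_fderiv one_ne_zero).comp (hT.continuous_time x)).clm_comp
    (hT.continuous_fderiv_time hξ hK hM x)

theorem hasFDerivAt_trajectoryIntegral (hT : IsGlobalFlow ξ T) (hξ : ContDiff ℝ 1 ξ)
    (hK : LipschitzWith K ξ) (hM : LipschitzWith M (fderiv ℝ ξ)) (hf : ContDiff ℝ 1 f)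
    (hL : LipschitzWith L f) (t : ℝ) (x : E) :
    HasFDerivAt (trajectoryIntegral T f t)
      (∫ s in (0 : ℝ)..t, fderiv ℝ f (T s x) ∘L fderiv ℝ (T s) x) x := by
  have continuous_comp : ∀ y, Continuous fun s => f (T s y) := fun y =>
    hf.continuous.comp (hT.continuous_time y)
  refine intervalIntegral.hasFDerivAt_integral_of_dominated_of_fderiv_le
    (F' := fun x s => fderiv ℝ f (T s x) ∘L fderiv ℝ (T s) x) Filter.univ_mem
    (Filter.Eventually.of_forall fun y => (continuous_comp y).aestronglyMeasurable)
    ((continuous_comp x).intervalIntegrable _ _)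
    (hT.continuous_fderiv_comp_fderiv_time hξ hK hM hf x).aestronglyMeasurable
    (Filter.Eventually.of_forall fun s hs y _ => hT.norm_fderiv_comp_fderiv_le hK hL hs y)
    intervalIntegrable_const (Filter.Eventually.of_forall fun s _ y _ => ?_)
  exact (hf.differentiable one_ne_zero _).hasFDerivAt.comp y
    ((hT.contDiff hξ hK hM s).differentiable one_ne_zero y).hasFDerivAt

theorem contDiff_trajectoryIntegral (hT : IsGlobalFlow ξ T) (hξ : ContDiff ℝ 1 ξ)
    (hK : LipschitzWith K ξ) (hM : LipschitzWith M (fderiv ℝ ξ)) (hf : ContDiff ℝ 1 f)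
    (hL : LipschitzWith L f) (t : ℝ) : ContDiff ℝ 1 (trajectoryIntegral T f t) := by
  have hasFDerivAt := hT.hasFDerivAt_trajectoryIntegral hξ hK hM hf hL t
  refine contDiff_one_iff_fderiv.2 ⟨fun x => (hasFDerivAt x).differentiableAt, ?_⟩
  rw [funext fun x => (hasFDerivAt x).fderiv]
  refine intervalIntegral.continuous_of_dominated_interval
    (fun x => (hT.continuous_fderiv_comp_fderiv_time hξ hK hM hf x).aestronglyMeasurable)
    (fun y => Filter.Eventually.of_forall fun s hs => hT.norm_fderiv_comp_fderiv_le hK hL hs y)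
    intervalIntegrable_const (Filter.Eventually.of_forall fun s _ => ?_)
  exact ((hf.continuous_fderiv one_ne_zero).comp (hT.contDiff hξ hK hM s).continuous).clm_comp
    ((hT.contDiff hξ hK hM s).continuous_fderiv one_ne_zero)

theorem norm_fderiv_trajectoryIntegral_le (hT : IsGlobalFlow ξ T) (hξ : ContDiff ℝ 1 ξ)
    (hK : LipschitzWith K ξ) (hM : LipschitzWith M (fderiv ℝ ξ)) (hf : ContDiff ℝ 1 f)
    (hL : LipschitzWith L f) (t : ℝ) (x : E) :
    ‖fderiv ℝ (trajectoryIntegral T f t) x‖ ≤ L * Real.exp (K * |t|) * |t| := by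
  rw [(hT.hasFDerivAt_trajectoryIntegral hξ hK hM hf hL t x).fderiv]
  simpa only [sub_zero] using intervalIntegral.norm_integral_le_of_norm_le_const
    fun s hs => hT.norm_fderiv_comp_fderiv_le hK hL hs x

theorem hasDerivAt_fderiv_trajectoryIntegral [CompleteSpace F] (hT : IsGlobalFlow ξ T)
    (hξ : ContDiff ℝ 1 ξ) (hK : LipschitzWith K ξ) (hM : LipschitzWith M (fderiv ℝ ξ))
    (hf : ContDiff ℝ 1 f) (hL : LipschitzWith L f) (t : ℝ) (x : E) :
    HasDerivAt (fun s => fderiv ℝ (trajectoryIntegral T f s) x)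
      (fderiv ℝ f (T t x) ∘L fderiv ℝ (T t) x) t := by
  simp only [fun s => (hT.hasFDerivAt_trajectoryIntegral hξ hK hM hf hL s x).fderiv]
  exact ((hT.continuous_fderiv_comp_fderiv_time hξ hK hM hf x).integral_hasStrictDerivAt
    0 t).hasDerivAt

end IsGlobalFlow

namespace IsGlobalFlow

variable [FiniteDimensional ℝ E]

theorem hasDerivAt_det_fderiv (hT : IsGlobalFlow ξ T) (hξ : ContDiff ℝ 1 ξ)
    (hK : LipschitzWith K ξ) (hM : LipschitzWith M (fderiv ℝ ξ)) (t : ℝ) (x : E) :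
    HasDerivAt (fun s => (fderiv ℝ (T s) x).det)
      (LinearMap.trace ℝ E (fderiv ℝ ξ (T t x)) * (fderiv ℝ (T t) x).det) t := by
  have := FiniteDimensional.complete ℝ E
  have fderiv_zero : ∀ y, fderiv ℝ (T 0) y = ContinuousLinearMap.id ℝ E := fun y => by
    rw [show T 0 = id from funext hT.1, fderiv_id]
  have derivAt_zero : ∀ y, HasDerivAt (fun s => (fderiv ℝ (T s) y).det)
      (LinearMap.trace ℝ E (fderiv ℝ ξ y)) 0 := fun y => by
    have h := hT.hasDerivAt_fderiv hξ hK hM 0 y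
    rw [fderiv_zero, ContinuousLinearMap.comp_id, hT.1] at h
    exact hasDerivAt_det_of_eq_id (fderiv_zero y) h
  have factor : (fun s => (fderiv ℝ (T s) x).det) =
      fun s => (fderiv ℝ (T (s - t)) (T t x)).det * (fderiv ℝ (T t) x).det := funext fun s => by
    have h := hT.fderiv_add hξ hK hM (s - t) t x
    rw [sub_add_cancel] at h
    rw [h]
    exact LinearMap.det_comp _ _
  rw [factor]
  exact (HasDerivAt.comp_sub_const (f := fun s => (fderiv ℝ (T s) (T t x)).det) t t
    (by simpa only [sub_self] using derivAt_zero (T t x))).mul_const _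

theorem det_fderiv (hT : IsGlobalFlow ξ T) (hξ : ContDiff ℝ 1 ξ) (hK : LipschitzWith K ξ)
    (hM : LipschitzWith M (fderiv ℝ ξ)) (t : ℝ) (x : E) :
    (fderiv ℝ (T t) x).det =
      Real.exp (trajectoryIntegral T (fun y => LinearMap.trace ℝ E (fderiv ℝ ξ y)) t x) := by
  set ℓ := trajectoryIntegral T fun y => LinearMap.trace ℝ E (fderiv ℝ ξ y) with hℓ
  have continuous_trace : Continuous fun y => LinearMap.trace ℝ E (fderiv ℝ ξ y) :=
    ((LinearMap.trace ℝ E) ∘ₗ ContinuousLinearMap.coeLM ℝ).continuous_of_finiteDimensional.comp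
      (hξ.continuous_fderiv one_ne_zero)
  have hasDerivAt_zero : ∀ s,
      HasDerivAt (fun r => (fderiv ℝ (T r) x).det * Real.exp (-ℓ r x)) 0 s := fun s => by
    refine ((hT.hasDerivAt_det_fderiv hξ hK hM s x).mul
      (hT.hasDerivAt_trajectoryIntegral continuous_trace s x).neg.exp).congr_deriv ?_
    ring
  have const := is_const_of_deriv_eq_zero (fun s => (hasDerivAt_zero s).differentiableAt)
    (fun s => (hasDerivAt_zero s).deriv) t 0
  have det_zero : (fderiv ℝ (T 0) x).det = 1 := by
    rw [show T 0 = id from funext hT.1, fderiv_id]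
    exact LinearMap.det_id
  simp only [det_zero, hℓ, trajectoryIntegral_zero, neg_zero, Real.exp_zero, mul_one] at const
  rwa [Real.exp_neg, mul_inv_eq_one₀ (Real.exp_pos _).ne'] at const

end IsGlobalFlow

end DirichletVariation

/-! ### Weak divergence and mollification -/

namespace DirichletVariation

open ContinuousLinearMap (lsmul)
open Filter Topology Convolution

section Mollification

variable {E F G H : Type*} [NormedAddCommGroup E] [NormedSpace ℝ E] [FiniteDimensional ℝ E]
  [MeasurableSpace E] [BorelSpace E] (μ : Measure E) [μ.IsAddHaarMeasure]
  [NormedAddCommGroup F] [NormedSpace ℝ F] [NormedAddCommGroup G] [NormedSpace ℝ G]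
  [NormedAddCommGroup H] [NormedSpace ℝ H] {k : E → F}

/-- Bump functions supported in the balls of radius `1 / (n + 1)` about the origin. -/
noncomputable def shrinkingBump (E : Type*) [NormedAddCommGroup E] (n : ℕ) :
    ContDiffBump (0 : E) where
  rIn := 1 / (n + 2)
  rOut := 1 / (n + 1)
  rIn_pos := by positivity
  rIn_lt_rOut := by gcongr; norm_num

/-- The mollification of `k` at scale `1 / (n + 1)`. -/
noncomputable def mollify (n : ℕ) (k : E → F) : E → F :=
  (shrinkingBump E n).normed μ ⋆[lsmul ℝ ℝ, μ] k

theorem contDiff_mollify (n : ℕ) (hk : Continuous k) : ContDiff ℝ ∞ (mollify μ n k) :=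
  (shrinkingBump E n).hasCompactSupport_normed.contDiff_convolution_left _
    (shrinkingBump E n).contDiff_normed hk.locallyIntegrable

theorem hasCompactSupport_mollify (n : ℕ) (hk : HasCompactSupport k) :
    HasCompactSupport (mollify μ n k) :=
  HasCompactSupport.convolution _ (shrinkingBump E n).hasCompactSupport_normed hk

theorem tendsto_mollify [CompleteSpace F] (hk : Continuous k) (x : E) :
    Tendsto (fun n => mollify μ n k x) atTop (𝓝 (k x)) :=
  ContDiffBump.convolution_tendsto_right_of_continuous (φ := fun n => shrinkingBump E n)
    tendsto_one_div_add_atTop_nhds_zero_nat hk x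

theorem norm_mollify_le (n : ℕ) {C : ℝ} (hC : ∀ x, ‖k x‖ ≤ C) (x : E) :
    ‖mollify μ n k x‖ ≤ C := by
  set η := (shrinkingBump E n).normed μ
  have norm_eq : ∀ y, ‖lsmul ℝ ℝ (η y) (k (x - y))‖ = η y * ‖k (x - y)‖ := fun y => by
    rw [ContinuousLinearMap.lsmul_apply, norm_smul,
      Real.norm_of_nonneg ((shrinkingBump E n).nonneg_normed y)]
  calc ‖mollify μ n k x‖ ≤ ∫ y, η y * C ∂μ := by
        refine norm_integral_le_of_norm_le
          ((shrinkingBump E n).integrable_normed.mul_const C) (Eventually.of_forall fun y => ?_)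
        rw [norm_eq]
        exact mul_le_mul_of_nonneg_left (hC _) ((shrinkingBump E n).nonneg_normed y)
    _ = C := by rw [integral_mul_const, (shrinkingBump E n).integral_normed, one_mul]

theorem support_mollify_subset (n : ℕ) (k : E → F) :
    Function.support (mollify μ n k) ⊆ Metric.cthickening 1 (tsupport k) := by
  intro x hx
  obtain ⟨y, hy, z, hz, rfl⟩ := Set.mem_add.1 (support_convolution_subset _ hx)
  rw [ContDiffBump.support_normed_eq, mem_ball_zero_iff] at hy
  refine Metric.mem_cthickening_of_dist_le _ z _ _ (subset_tsupport _ hz) ?_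
  rw [dist_eq_norm, add_sub_cancel_right]
  exact hy.le.trans (div_le_one_of_le₀ (by simp) (by positivity))

theorem tendsto_integral_mollify [CompleteSpace G] (L : F →L[ℝ] G →L[ℝ] H) {h : E → F}
    {k : E → G} (hh : LocallyIntegrable h μ) (hk : Continuous k) (hkc : HasCompactSupport k) :
    Tendsto (fun n => ∫ x, L (h x) (mollify μ n k x) ∂μ) atTop (𝓝 (∫ x, L (h x) (k x) ∂μ)) := by
  obtain ⟨C, hC⟩ := hkc.exists_bound_of_continuous hk
  have : 0 ≤ C := (norm_nonneg _).trans (hC 0)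
  set S := Metric.cthickening 1 (tsupport k)
  have hS : IsCompact S := hkc.isCompact.cthickening
  refine tendsto_integral_of_dominated_convergence (S.indicator fun x => ‖L‖ * ‖h x‖ * C)
    (fun n => L.aestronglyMeasurable_comp₂ hh.aestronglyMeasurable
      (contDiff_mollify μ n hk).continuous.aestronglyMeasurable)
    ?_ (fun n => Eventually.of_forall fun x => ?_)
    (Eventually.of_forall fun x => ((L (h x)).continuous.tendsto _).comp (tendsto_mollify μ hk x))
  · rw [integrable_indicator_iff hS.measurableSet]
    exact ((hh.integrableOn_isCompact hS).norm.const_mul _).mul_const _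
  · by_cases hx : x ∈ S
    · rw [Set.indicator_of_mem hx]
      exact (L.le_opNorm₂ _ _).trans (by gcongr; exact norm_mollify_le μ n hC x)
    · rw [Set.indicator_of_notMem hx,
        Function.notMem_support.1 fun hx' => hx (support_mollify_subset μ n k hx'), map_zero,
        norm_zero]

/-- The function `f₀` is the distributional divergence `∇ · f` of the vector field `f`. -/
def IsWeakDivergence (f : E → E) (f₀ : E → ℝ) : Prop :=
  ∀ w : E → ℝ, ContDiff ℝ ∞ w → HasCompactSupport w →
    ∫ x, w x * f₀ x ∂μ = -∫ x, fderiv ℝ w x (f x) ∂μ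

theorem trace_fderiv_mollify (n : ℕ) {f : E → E} (hf : Continuous f) (x : E) :
    LinearMap.trace ℝ E (fderiv ℝ (mollify μ n f) x) =
      ∫ y, fderiv ℝ ((shrinkingBump E n).normed μ) (x - y) (f y) ∂μ := by
  have := FiniteDimensional.complete ℝ E
  set η := (shrinkingBump E n).normed μ
  have hηc : HasCompactSupport η := (shrinkingBump E n).hasCompactSupport_normed
  have hη1 : ContDiff ℝ 1 η := (shrinkingBump E n).contDiff_normed
  let trace : (E →L[ℝ] E) →L[ℝ] ℝ :=
    ((LinearMap.trace ℝ E) ∘ₗ ContinuousLinearMap.coeLM ℝ).toContinuousLinearMap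
  have fderiv_eq : fderiv ℝ (mollify μ n f) x =
      ∫ y, (fderiv ℝ η (x - y)).smulRight (f y) ∂μ := by
    refine (hηc.hasFDerivAt_convolution_left (lsmul ℝ ℝ) hη1
      (hf.locallyIntegrable (μ := μ)) x).fderiv.trans ?_
    rw [convolution_eq_swap]
    rfl
  have integrable : Integrable (fun y => (fderiv ℝ η (x - y)).smulRight (f y)) μ :=
    ((hηc.fderiv ℝ).convolutionExists_left ((lsmul ℝ ℝ).precompL E)
      (hη1.continuous_fderiv one_ne_zero) (hf.locallyIntegrable (μ := μ)) x).integrable_swap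
  rw [fderiv_eq]
  refine (trace.integral_comp_comm integrable).symm.trans (integral_congr_ae ?_)
  exact Eventually.of_forall fun y => LinearMap.trace_smulRight _ _

variable {μ}

theorem IsWeakDivergence.trace_fderiv_mollify_eq {f : E → E} {f₀ : E → ℝ}
    (h : IsWeakDivergence μ f f₀) (n : ℕ) (hf : Continuous f) (x : E) :
    LinearMap.trace ℝ E (fderiv ℝ (mollify μ n f) x) = mollify μ n f₀ x := by
  set η := (shrinkingBump E n).normed μ with hη
  have hη1 : ContDiff ℝ ∞ η := (shrinkingBump E n).contDiff_normed
  have fderiv_reflect : ∀ y, fderiv ℝ (fun y => η (x - y)) y = -fderiv ℝ η (x - y) := fun y => by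
    simpa only [Function.comp_def, ContinuousLinearMap.comp_neg, ContinuousLinearMap.comp_id] using
      ((hη1.differentiable (by simp) (x - y)).hasFDerivAt.comp y
        ((hasFDerivAt_id y).const_sub x)).fderiv
  have test := h (fun y => η (x - y)) (hη1.comp (contDiff_const.sub contDiff_id))
    ((shrinkingBump E n).hasCompactSupport_normed.comp_homeomorph (Homeomorph.subLeft x))
  simp only [fderiv_reflect, _root_.neg_apply, integral_neg, neg_neg] at test
  rw [trace_fderiv_mollify μ n hf, ← hη, ← test, mollify, convolution_eq_swap]
  rfl

end Mollification

section WeakGradient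

variable {d : ℕ} {u : Space d → ℝ} {g : Space d → Space d}

theorem stdVec_eq_basisFun (i : Fin d) :
    (stdVec i : Space d) = EuclideanSpace.basisFun (Fin d) ℝ i :=
  (EuclideanSpace.basisFun_apply (Fin d) ℝ i).symm

theorem inner_stdVec (v : Space d) (i : Fin d) : inner ℝ v (stdVec i) = v i := by
  simp [stdVec, EuclideanSpace.inner_single_right]

theorem divergence_eq_trace (f : Space d → Space d) :
    divergence f = fun x => LinearMap.trace ℝ (Space d) (fderiv ℝ f x) := by
  funext x
  rw [LinearMap.trace_eq_sum_inner _ (EuclideanSpace.basisFun (Fin d) ℝ)]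
  refine Finset.sum_congr rfl fun i _ => ?_
  rw [← stdVec_eq_basisFun, real_inner_comm]
  exact (inner_stdVec _ i).symm

theorem IsWeakGradient.integral_mul_divergence (hg : IsWeakGradient u g) {f : Space d → Space d}
    (hf : ContDiff ℝ ∞ f) (hfc : HasCompactSupport f) :
    ∫ x, u x * divergence f x = -∫ x, inner ℝ (g x) (f x) := by
  have coord_contDiff : ∀ i, ContDiff ℝ ∞ fun x => f x i := fun i =>
    (EuclideanSpace.proj (𝕜 := ℝ) i).contDiff.comp hf
  have coord_hasCompactSupport : ∀ i, HasCompactSupport fun x => f x i := fun i =>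
    hfc.comp_left (g := fun v : Space d => v i) rfl
  have fderiv_coord : ∀ i x, fderiv ℝ (fun y => f y i) x (stdVec i) =
      fderiv ℝ f x (stdVec i) i := fun i x =>
    congrArg (· (stdVec i)) ((EuclideanSpace.proj (𝕜 := ℝ) i).hasFDerivAt.comp x
      (hf.differentiable (by simp) x).hasFDerivAt).fderiv
  have integrable_lhs : ∀ i, Integrable fun x => u x * fderiv ℝ (fun y => f y i) x (stdVec i) :=
    fun i => hg.1.integrable_smul_right_of_hasCompactSupport
      (((coord_contDiff i).continuous_fderiv (by simp)).clm_apply continuous_const)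
      ((coord_hasCompactSupport i).fderiv_apply ℝ _)
  have integrable_rhs : ∀ i, Integrable fun x => g x i * f x i := fun i => by
    simpa only [PiLp.smul_apply, smul_eq_mul, mul_comm] using
      (hg.2.1.integrable_smul_left_of_hasCompactSupport (coord_contDiff i).continuous
        (coord_hasCompactSupport i)).eval_piLp i
  calc ∫ x, u x * divergence f x
      = ∑ i, ∫ x, u x * fderiv ℝ (fun y => f y i) x (stdVec i) := by
        rw [← integral_finsetSum _ fun i _ => integrable_lhs i]
        simp only [divergence, Finset.mul_sum, fderiv_coord]
    _ = ∑ i, -∫ x, g x i * f x i := Finset.sum_congr rfl fun i _ =>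
        hg.2.2 _ (coord_contDiff i) (coord_hasCompactSupport i) i
    _ = -∫ x, inner ℝ (g x) (f x) := by
        rw [Finset.sum_neg_distrib, ← integral_finsetSum _ fun i _ => integrable_rhs i]
        simp only [PiLp.inner_apply, RCLike.inner_apply, conj_trivial, mul_comm]

theorem IsWeakGradient.integral_mul_eq_of_isWeakDivergence (hg : IsWeakGradient u g)
    {f : Space d → Space d} {f₀ : Space d → ℝ} (hf : Continuous f) (hfc : HasCompactSupport f)
    (hf₀ : Continuous f₀) (hf₀c : HasCompactSupport f₀) (hdiv : IsWeakDivergence volume f f₀) :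
    ∫ x, u x * f₀ x = -∫ x, inner ℝ (g x) (f x) := by
  have mollified : ∀ n, ∫ x, u x * mollify volume n f₀ x =
      -∫ x, inner ℝ (g x) (mollify volume n f x) := fun n => by
    rw [← hg.integral_mul_divergence (contDiff_mollify volume n hf)
      (hasCompactSupport_mollify volume n hfc), divergence_eq_trace]
    simp only [hdiv.trace_fderiv_mollify_eq n hf]
  refine tendsto_nhds_unique
    (tendsto_integral_mollify volume (ContinuousLinearMap.mul ℝ ℝ) hg.1 hf₀ hf₀c) ?_
  simp only [ContinuousLinearMap.mul_apply', mollified]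
  exact (tendsto_integral_mollify volume (innerSL ℝ) hg.2.1 hf hfc).neg

end WeakGradient

end DirichletVariation

/-! ### Densities and weak gradients under a diffeomorphism -/

namespace DirichletVariation

open InnerProductSpace (toDual toDual_symm_apply)

section PushDensity

variable {α F : Type*} [TopologicalSpace α] [NormedAddCommGroup F] [NormedSpace ℝ F]

/-- The push-forward of the density `f` under a map `Φ` with Jacobian determinant `exp ℓ`. -/
noncomputable def pushDensity (Φ : α ≃ₜ α) (ℓ : α → ℝ) (f : α → F) (x : α) : F :=
  Real.exp (-ℓ (Φ.symm x)) • f (Φ.symm x)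

theorem pushDensity_apply (Φ : α ≃ₜ α) (ℓ : α → ℝ) (f : α → F) (y : α) :
    pushDensity Φ ℓ f (Φ y) = Real.exp (-ℓ y) • f y := by
  rw [pushDensity, Φ.symm_apply_apply]

end PushDensity

section LogJacobian

variable {E F : Type*} [NormedAddCommGroup E] [NormedSpace ℝ E] [NormedAddCommGroup F]

/-- `Φ` is a `C¹` diffeomorphism with Jacobian determinant `exp ℓ`, where `ℓ` is `C¹`. -/
structure HasLogJacobian (Φ : E ≃ₜ E) (ℓ : E → ℝ) : Prop where
  contDiff : ContDiff ℝ 1 Φ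
  contDiff_symm : ContDiff ℝ 1 Φ.symm
  contDiff_log : ContDiff ℝ 1 ℓ
  det_fderiv : ∀ y, (fderiv ℝ Φ y).det = Real.exp (ℓ y)

namespace HasLogJacobian

variable {Φ : E ≃ₜ E} {ℓ : E → ℝ}

theorem hasFDerivAt (h : HasLogJacobian Φ ℓ) (y : E) : HasFDerivAt Φ (fderiv ℝ Φ y) y :=
  (h.contDiff.differentiable one_ne_zero y).hasFDerivAt

theorem hasFDerivAt_symm (h : HasLogJacobian Φ ℓ) (x : E) :
    HasFDerivAt Φ.symm (fderiv ℝ Φ.symm x) x :=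
  (h.contDiff_symm.differentiable one_ne_zero x).hasFDerivAt

theorem inverse_fderiv (h : HasLogJacobian Φ ℓ) (y : E) :
    (fderiv ℝ Φ y).inverse = fderiv ℝ Φ.symm (Φ y) := by
  have hΦ : HasFDerivAt Φ (fderiv ℝ Φ y) (Φ.symm (Φ y)) := by
    simpa only [Φ.symm_apply_apply] using h.hasFDerivAt y
  refine ContinuousLinearMap.inverse_eq ?_ ?_
  · rw [← (hΦ.comp (Φ y) (h.hasFDerivAt_symm (Φ y))).fderiv, Φ.self_comp_symm, fderiv_id]
  · rw [← ((h.hasFDerivAt_symm (Φ y)).comp y (h.hasFDerivAt y)).fderiv, Φ.symm_comp_self,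
      fderiv_id]

theorem continuous_inverse_fderiv (h : HasLogJacobian Φ ℓ) :
    Continuous fun y => (fderiv ℝ Φ y).inverse := by
  simp only [h.inverse_fderiv]
  exact (h.contDiff_symm.continuous_fderiv one_ne_zero).comp Φ.continuous

theorem contDiff_pushDensity [NormedSpace ℝ F] (h : HasLogJacobian Φ ℓ) {f : E → F}
    (hf : ContDiff ℝ 1 f) : ContDiff ℝ 1 (pushDensity Φ ℓ f) :=
  (Real.contDiff_exp.comp (h.contDiff_log.comp h.contDiff_symm).neg).smul
    (hf.comp h.contDiff_symm)

theorem fderiv_pushDensity (h : HasLogJacobian Φ ℓ) {w : E → ℝ} (hw : Differentiable ℝ w)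
    (y : E) :
    fderiv ℝ (pushDensity Φ ℓ w) (Φ y) =
      Real.exp (-ℓ y) • (fderiv ℝ w y - w y • fderiv ℝ ℓ y) ∘L (fderiv ℝ Φ y).inverse := by
  have hasFDerivAt : HasFDerivAt (fun z => Real.exp (-ℓ z) • w z)
      (Real.exp (-ℓ y) • (fderiv ℝ w y - w y • fderiv ℝ ℓ y)) y := by
    refine ((h.contDiff_log.differentiable one_ne_zero y).hasFDerivAt.neg.exp.smul
      (hw y).hasFDerivAt).congr_fderiv ?_
    ext v
    simp only [_root_.add_apply, _root_.sub_apply, _root_.smul_apply, _root_.neg_apply,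
      Pi.neg_apply, ContinuousLinearMap.smulRight_apply, smul_eq_mul]
    ring
  rw [h.inverse_fderiv]
  rw [← Φ.symm_apply_apply y] at hasFDerivAt
  refine (hasFDerivAt.comp (Φ y) (h.hasFDerivAt_symm (Φ y))).fderiv.trans ?_
  rw [Φ.symm_apply_apply, ContinuousLinearMap.smul_comp]

variable [FiniteDimensional ℝ E] [MeasurableSpace E] [BorelSpace E] {μ : Measure E}
  [μ.IsAddHaarMeasure]

theorem integral_exp_smul_comp [NormedSpace ℝ F] (h : HasLogJacobian Φ ℓ) (f : E → F) :
    ∫ y, Real.exp (ℓ y) • f (Φ y) ∂μ = ∫ x, f x ∂μ := by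
  have changeOfVariables := integral_image_eq_integral_abs_det_fderiv_smul μ MeasurableSet.univ
    (fun y _ => (h.hasFDerivAt y).hasFDerivWithinAt) Φ.injective.injOn f
  simpa only [h.det_fderiv, abs_of_pos (Real.exp_pos _), Measure.restrict_univ, Set.image_univ,
    Φ.surjective.range_eq] using changeOfVariables.symm

theorem integral_pushDensity_mul (h : HasLogJacobian Φ ℓ) (u ζ : E → ℝ) :
    ∫ x, pushDensity Φ ℓ u x * ζ x ∂μ = ∫ y, u y * ζ (Φ y) ∂μ := by
  rw [← h.integral_exp_smul_comp]
  simp only [pushDensity_apply, smul_eq_mul, ← mul_assoc, ← Real.exp_add, add_neg_cancel,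
    Real.exp_zero, one_mul]

theorem map_symm (h : HasLogJacobian Φ ℓ) :
    μ.map Φ.symm = μ.withDensity fun y => ENNReal.ofReal (Real.exp (ℓ y)) := by
  have changeOfVariables := map_withDensity_abs_det_fderiv_eq_addHaar μ nullMeasurableSet_univ
    (fun y _ => (h.hasFDerivAt y).hasFDerivWithinAt) Φ.injective.injOn
  simp only [h.det_fderiv, abs_of_pos (Real.exp_pos _), Measure.restrict_univ, Set.image_univ,
    Φ.surjective.range_eq] at changeOfVariables
  conv_lhs => rw [← changeOfVariables]
  rw [Measure.map_map Φ.symm.continuous.measurable Φ.continuous.measurable,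
    Φ.symm_comp_self, Measure.map_id]

variable {f : E → F} {p : ENNReal} {C : ℝ}

theorem memLp_comp_symm (h : HasLogJacobian Φ ℓ) (hC : ∀ y, |ℓ y| ≤ C) (hf : MemLp f p μ) :
    MemLp (fun x => f (Φ.symm x)) p μ := by
  have map_le : μ.map Φ.symm ≤ ENNReal.ofReal (Real.exp C) • μ := by
    rw [h.map_symm, ← withDensity_const]
    exact withDensity_mono (Filter.Eventually.of_forall fun y =>
      ENNReal.ofReal_le_ofReal (Real.exp_le_exp.2 ((le_abs_self _).trans (hC y))))
  exact (hf.of_measure_le_smul ENNReal.ofReal_ne_top map_le).comp_of_map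
    Φ.symm.continuous.aemeasurable

theorem memLp_pushDensity [NormedSpace ℝ F] (h : HasLogJacobian Φ ℓ) (hC : ∀ y, |ℓ y| ≤ C)
    (hf : MemLp f p μ) : MemLp (pushDensity Φ ℓ f) p μ := by
  refine h.memLp_comp_symm hC (f := fun y => Real.exp (-ℓ y) • f y)
    (hf.of_le_mul (c := Real.exp C) ?_ (Filter.Eventually.of_forall fun y => ?_))
  · exact (Real.continuous_exp.comp h.contDiff_log.continuous.neg).aestronglyMeasurable.smul hf.1
  · rw [norm_smul, Real.norm_of_nonneg (Real.exp_pos _).le]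
    gcongr
    exact (neg_le_abs _).trans (hC y)

end HasLogJacobian

end LogJacobian

section PullbackField

variable {E : Type*} [NormedAddCommGroup E] [NormedSpace ℝ E]

/-- The pull-back of the vector field `φ • v` under the diffeomorphism `Φ`. -/
noncomputable def pullbackField (Φ : E → E) (φ : E → ℝ) (v : E) (y : E) : E :=
  φ (Φ y) • (fderiv ℝ Φ y).inverse v

/-- The distributional divergence of `pullbackField Φ φ v`. By Piola's identity it involves no
derivative of `(DΦ)⁻¹`, which need not exist for a `C¹` map `Φ`. -/
noncomputable def pullbackFieldDivergence (Φ : E → E) (ℓ φ : E → ℝ) (v : E) (y : E) : ℝ :=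
  fderiv ℝ φ (Φ y) v - fderiv ℝ ℓ y (pullbackField Φ φ v y)

theorem integral_mul_fderiv_add_fderiv_mul_eq_zero [FiniteDimensional ℝ E] [MeasurableSpace E]
    [BorelSpace E] {μ : Measure E} [μ.IsAddHaarMeasure] {f φ : E → ℝ} (hf : ContDiff ℝ 1 f)
    (hφ : ContDiff ℝ 1 φ) (hφc : HasCompactSupport φ) (v : E) :
    ∫ x, (f x * fderiv ℝ φ x v + fderiv ℝ f x v * φ x) ∂μ = 0 := by
  have continuous_df : Continuous fun x => fderiv ℝ f x v :=
    (hf.continuous_fderiv one_ne_zero).clm_apply continuous_const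
  have continuous_dφ : Continuous fun x => fderiv ℝ φ x v :=
    (hφ.continuous_fderiv one_ne_zero).clm_apply continuous_const
  have integrable_mul_dφ : Integrable (fun x => f x * fderiv ℝ φ x v) μ :=
    (hf.continuous.mul continuous_dφ).integrable_of_hasCompactSupport
      (hφc.fderiv_apply ℝ v).mul_left
  have integrable_df_mul : Integrable (fun x => fderiv ℝ f x v * φ x) μ :=
    (continuous_df.mul hφ.continuous).integrable_of_hasCompactSupport hφc.mul_left
  rw [integral_add integrable_mul_dφ integrable_df_mul,
    integral_mul_fderiv_eq_neg_fderiv_mul_of_integrable integrable_df_mul integrable_mul_dφ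
      ((hf.continuous.mul hφ.continuous).integrable_of_hasCompactSupport hφc.mul_left)
      (fun x _ => hf.differentiable one_ne_zero x) (fun x _ => hφ.differentiable one_ne_zero x),
    neg_add_cancel]

theorem hasCompactSupport_pullbackField {Φ : E ≃ₜ E} {φ : E → ℝ} (hφc : HasCompactSupport φ)
    (v : E) : HasCompactSupport (pullbackField Φ φ v) :=
  (hφc.comp_homeomorph Φ).smul_right

theorem hasCompactSupport_pullbackFieldDivergence {Φ : E ≃ₜ E} {φ : E → ℝ} (ℓ : E → ℝ)
    (hφc : HasCompactSupport φ) (v : E) :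
    HasCompactSupport (pullbackFieldDivergence Φ ℓ φ v) :=
  ((hφc.fderiv_apply ℝ v).comp_homeomorph Φ).sub
    ((hasCompactSupport_pullbackField (Φ := Φ) hφc v).mono fun y hy hy' =>
      hy (by simp only [hy', map_zero]))

namespace HasLogJacobian

variable {Φ : E ≃ₜ E} {ℓ φ : E → ℝ}

theorem continuous_pullbackField (h : HasLogJacobian Φ ℓ) (hφ : Continuous φ) (v : E) :
    Continuous (pullbackField Φ φ v) :=
  (hφ.comp Φ.continuous).smul (h.continuous_inverse_fderiv.clm_apply continuous_const)

theorem continuous_pullbackFieldDivergence (h : HasLogJacobian Φ ℓ) (hφ : ContDiff ℝ 1 φ)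
    (v : E) : Continuous (pullbackFieldDivergence Φ ℓ φ v) :=
  (((hφ.continuous_fderiv one_ne_zero).comp Φ.continuous).clm_apply continuous_const).sub
    ((h.contDiff_log.continuous_fderiv one_ne_zero).clm_apply
      (h.continuous_pullbackField hφ.continuous v))

theorem isWeakDivergence_pullbackField [FiniteDimensional ℝ E] [MeasurableSpace E]
    [BorelSpace E] {μ : Measure E} [μ.IsAddHaarMeasure] (h : HasLogJacobian Φ ℓ)
    (hφ : ContDiff ℝ 1 φ) (hφc : HasCompactSupport φ) (v : E) :
    IsWeakDivergence μ (pullbackField Φ φ v) (pullbackFieldDivergence Φ ℓ φ v) := by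
  intro w hw hwc
  have hw1 : ContDiff ℝ 1 w := hw.of_le (by simp)
  have integrable_mul : Integrable (fun y => w y * pullbackFieldDivergence Φ ℓ φ v y) μ :=
    (hw.continuous.mul (h.continuous_pullbackFieldDivergence hφ v)).integrable_of_hasCompactSupport
      hwc.mul_right
  have integrable_fderiv : Integrable (fun y => fderiv ℝ w y (pullbackField Φ φ v y)) μ :=
    ((hw1.continuous_fderiv one_ne_zero).clm_apply
      (h.continuous_pullbackField hφ.continuous v)).integrable_of_hasCompactSupport
      ((hwc.fderiv ℝ).mono fun y hy hy' => hy (by simp only [hy', _root_.zero_apply]))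
  have byParts := integral_mul_fderiv_add_fderiv_mul_eq_zero (μ := μ)
    (h.contDiff_pushDensity hw1) hφ hφc v
  rw [← h.integral_exp_smul_comp] at byParts
  rw [eq_neg_iff_add_eq_zero, ← integral_add integrable_mul integrable_fderiv, ← byParts]
  refine integral_congr_ae (Filter.Eventually.of_forall fun y => ?_)
  simp only [pullbackFieldDivergence, pullbackField, pushDensity_apply,
    h.fderiv_pushDensity (hw1.differentiable one_ne_zero), ContinuousLinearMap.comp_apply,
    _root_.sub_apply, _root_.smul_apply, map_smul, smul_eq_mul, Real.exp_neg]
  field_simp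
  ring

end HasLogJacobian

end PullbackField

section PullGrad

variable {E : Type*} [NormedAddCommGroup E] [InnerProductSpace ℝ E] [CompleteSpace E]

/-- The gradient of the push-forward of the density `u` under `Φ`, transported back by `Φ` and
stripped of the factor `exp (-ℓ)`: it is `(DΦ)⁻ᵀ (g - u ∇ℓ)`, where `g` is the gradient of `u`
and `exp ℓ` is the Jacobian determinant of `Φ`. -/
noncomputable def pullGrad (Φ : E → E) (ℓ u : E → ℝ) (g : E → E) (y : E) : E :=
  (toDual ℝ E).symm ((toDual ℝ E (g y) - u y • fderiv ℝ ℓ y) ∘L (fderiv ℝ Φ y).inverse)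

theorem inner_pullGrad (Φ : E → E) (ℓ u : E → ℝ) (g : E → E) (y v : E) :
    inner ℝ (pullGrad Φ ℓ u g y) v =
      inner ℝ (g y) ((fderiv ℝ Φ y).inverse v) - u y * fderiv ℝ ℓ y ((fderiv ℝ Φ y).inverse v) :=
  toDual_symm_apply

theorem norm_pullGrad_le (Φ : E → E) (ℓ u : E → ℝ) (g : E → E) (y : E) :
    ‖pullGrad Φ ℓ u g y‖ ≤
      (‖g y‖ + |u y| * ‖fderiv ℝ ℓ y‖) * ‖(fderiv ℝ Φ y).inverse‖ := by
  rw [pullGrad, LinearIsometryEquiv.norm_map]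
  refine (ContinuousLinearMap.opNorm_comp_le _ _).trans ?_
  gcongr
  refine (norm_sub_le _ _).trans_eq ?_
  rw [LinearIsometryEquiv.norm_map, norm_smul, Real.norm_eq_abs]

variable [SecondCountableTopology E] [MeasurableSpace E] [OpensMeasurableSpace E] {μ : Measure E}
  {Φ : E → E} {ℓ u : E → ℝ} {g : E → E} {p : ENNReal} {A B : ℝ}

theorem aestronglyMeasurable_pullGrad (hΦ : Continuous fun y => (fderiv ℝ Φ y).inverse)
    (hℓ : Continuous (fderiv ℝ ℓ)) (hu : AEStronglyMeasurable u μ)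
    (hg : AEStronglyMeasurable g μ) : AEStronglyMeasurable (pullGrad Φ ℓ u g) μ := by
  have covector : AEStronglyMeasurable (fun y => toDual ℝ E (g y) - u y • fderiv ℝ ℓ y) μ :=
    ((toDual ℝ E).continuous.comp_aestronglyMeasurable hg).sub
      (hu.smul hℓ.aestronglyMeasurable)
  exact (toDual ℝ E).symm.continuous.comp_aestronglyMeasurable
    ((ContinuousLinearMap.compL ℝ E E ℝ).aestronglyMeasurable_comp₂ covector
      hΦ.aestronglyMeasurable)

theorem memLp_pullGrad (hΦ : Continuous fun y => (fderiv ℝ Φ y).inverse)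
    (hℓ : Continuous (fderiv ℝ ℓ)) (hA : ∀ y, ‖(fderiv ℝ Φ y).inverse‖ ≤ A)
    (hB : ∀ y, ‖fderiv ℝ ℓ y‖ ≤ B) (hu : MemLp u p μ) (hg : MemLp g p μ) :
    MemLp (pullGrad Φ ℓ u g) p μ := by
  refine (hg.norm.add (hu.norm.mul_const B)).of_le_mul (c := A)
    (aestronglyMeasurable_pullGrad hΦ hℓ hu.1 hg.1) (Filter.Eventually.of_forall fun y => ?_)
  have hB0 : 0 ≤ B := (norm_nonneg _).trans (hB y)
  simp only [Pi.add_apply]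
  rw [Real.norm_eq_abs (u y), Real.norm_of_nonneg (by positivity), mul_comm]
  refine (norm_pullGrad_le Φ ℓ u g y).trans ?_
  gcongr
  exacts [hB y, hA y]

end PullGrad

section WeakGradient

variable {d : ℕ} {Φ : Space d ≃ₜ Space d} {ℓ u v : Space d → ℝ} {g g' : Space d → Space d}
  {A B C : ℝ}

theorem IsWeakGradient.integral_mul_fderiv_comp (hg : IsWeakGradient u g)
    (h : HasLogJacobian Φ ℓ) {φ : Space d → ℝ} (hφ : ContDiff ℝ 1 φ) (hφc : HasCompactSupport φ)
    (e : Space d) :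
    ∫ y, u y * fderiv ℝ φ (Φ y) e = -∫ y, inner ℝ (pullGrad Φ ℓ u g y) e * φ (Φ y) := by
  set f := pullbackField Φ φ e
  set f₀ := pullbackFieldDivergence Φ ℓ φ e
  have hf : Continuous f := h.continuous_pullbackField hφ.continuous e
  have hfc : HasCompactSupport f := hasCompactSupport_pullbackField hφc e
  have hf₀ : Continuous f₀ := h.continuous_pullbackFieldDivergence hφ e
  have hf₀c : HasCompactSupport f₀ := hasCompactSupport_pullbackFieldDivergence ℓ hφc e
  have integrable_divergence : Integrable fun y => u y * f₀ y :=
    hg.1.integrable_smul_right_of_hasCompactSupport hf₀ hf₀c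
  have integrable_log : Integrable fun y => u y * fderiv ℝ ℓ y (f y) :=
    hg.1.integrable_smul_right_of_hasCompactSupport
      ((h.contDiff_log.continuous_fderiv one_ne_zero).clm_apply hf)
      (hfc.mono fun y hy hy' => hy (by simp only [hy', map_zero]))
  have integrable_inner : Integrable fun y => inner ℝ (g y) (f y) := by
    refine (hg.2.1.integrable_smul_left_of_hasCompactSupport hf.norm hfc.norm).mono
      (hg.2.1.aestronglyMeasurable.inner hf.aestronglyMeasurable)
      (Filter.Eventually.of_forall fun y => (norm_inner_le_norm _ _).trans_eq ?_)
    rw [norm_smul, norm_norm, mul_comm]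
  calc ∫ y, u y * fderiv ℝ φ (Φ y) e
      = ∫ y, (u y * f₀ y + u y * fderiv ℝ ℓ y (f y)) := by
        simp only [f₀, f, pullbackFieldDivergence, ← mul_add, sub_add_cancel]
    _ = -∫ y, (inner ℝ (g y) (f y) - u y * fderiv ℝ ℓ y (f y)) := by
        rw [integral_add integrable_divergence integrable_log,
          integral_sub integrable_inner integrable_log,
          hg.integral_mul_eq_of_isWeakDivergence hf hfc hf₀ hf₀c
            (h.isWeakDivergence_pullbackField hφ hφc e)]
        ring
    _ = -∫ y, inner ℝ (pullGrad Φ ℓ u g y) e * φ (Φ y) := by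
        congr 2 with y
        simp only [inner_pullGrad, f, pullbackField, inner_smul_right, map_smul, smul_eq_mul]
        ring

theorem IsWeakGradient.ae_eq (hg : IsWeakGradient u g) (hg' : IsWeakGradient u g') :
    g =ᵐ[volume] g' := by
  have locallyIntegrable_coord : ∀ {k : Space d → Space d}, LocallyIntegrable k →
      ∀ i, LocallyIntegrable fun x => k x i := fun hk i x =>
    (hk x).imp fun _ hs => ⟨hs.1, hs.2.eval_piLp i⟩
  have coord : ∀ i, ∀ᵐ x, g x i = g' x i := fun i => by
    refine ae_eq_of_integral_contDiff_smul_eq (locallyIntegrable_coord hg.2.1 i)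
      (locallyIntegrable_coord hg'.2.1 i) fun φ hφ hφc => ?_
    simp only [smul_eq_mul, mul_comm (φ _)]
    exact neg_injective ((hg.2.2 φ hφ hφc i).symm.trans (hg'.2.2 φ hφ hφc i))
  filter_upwards [ae_all_iff.2 coord] with x hx
  exact PiLp.ext hx

theorem IsWeakGradient.isWeakGradient_weakGrad (hg : IsWeakGradient u g) :
    IsWeakGradient u (weakGrad u) := by
  rw [weakGrad, dif_pos ⟨g, hg⟩]
  exact Exists.choose_spec (p := IsWeakGradient u) ⟨g, hg⟩

theorem IsWeakGradient.weakGrad_ae_eq (hg : IsWeakGradient u g) : weakGrad u =ᵐ[volume] g :=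
  hg.isWeakGradient_weakGrad.ae_eq hg

theorem MemH1.isWeakGradient_weakGrad (hu : MemH1 u) : IsWeakGradient u (weakGrad u) :=
  let ⟨_, _, _, hg⟩ := hu
  hg.isWeakGradient_weakGrad

theorem MemH1.memLp_weakGrad (hu : MemH1 u) : MemLp (weakGrad u) 2 :=
  let ⟨_, _, hg2, hg⟩ := hu
  (memLp_congr_ae hg.weakGrad_ae_eq).2 hg2

theorem MemH1.memLp_pushDensity_pullGrad (hu : MemH1 u) (h : HasLogJacobian Φ ℓ)
    (hA : ∀ y, ‖(fderiv ℝ Φ y).inverse‖ ≤ A) (hB : ∀ y, ‖fderiv ℝ ℓ y‖ ≤ B)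
    (hC : ∀ y, |ℓ y| ≤ C) : MemLp (pushDensity Φ ℓ (pullGrad Φ ℓ u (weakGrad u))) 2 :=
  h.memLp_pushDensity hC (memLp_pullGrad h.continuous_inverse_fderiv
    (h.contDiff_log.continuous_fderiv one_ne_zero) hA hB hu.1 hu.memLp_weakGrad)

namespace IsPushforward

theorem ae_eq_pushDensity (hv : IsPushforward Φ u v) (h : HasLogJacobian Φ ℓ)
    (hC : ∀ y, |ℓ y| ≤ C) (hu : MemLp u 2) : v =ᵐ[volume] pushDensity Φ ℓ u := by
  refine ae_eq_of_integral_contDiff_smul_eq hv.1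
    ((h.memLp_pushDensity hC hu).locallyIntegrable (by norm_num)) fun φ hφ hφc => ?_
  simp only [smul_eq_mul, mul_comm (φ _)]
  rw [hv.2 φ hφ.continuous hφc, h.integral_pushDensity_mul]

theorem isWeakGradient (hv : IsPushforward Φ u v) (h : HasLogJacobian Φ ℓ)
    (hA : ∀ y, ‖(fderiv ℝ Φ y).inverse‖ ≤ A) (hB : ∀ y, ‖fderiv ℝ ℓ y‖ ≤ B)
    (hC : ∀ y, |ℓ y| ≤ C) (hu : MemH1 u) :
    IsWeakGradient v (pushDensity Φ ℓ (pullGrad Φ ℓ u (weakGrad u))) := by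
  refine ⟨hv.1, (hu.memLp_pushDensity_pullGrad h hA hB hC).locallyIntegrable (by norm_num),
    fun φ hφ hφc i => ?_⟩
  rw [hv.2 _ ((hφ.continuous_fderiv (by simp)).clm_apply continuous_const)
    (hφc.fderiv_apply ℝ (stdVec i)),
    hu.isWeakGradient_weakGrad.integral_mul_fderiv_comp h (hφ.of_le (by simp)) hφc]
  simp only [inner_stdVec]
  rw [← h.integral_pushDensity_mul]
  rfl

theorem memH1 (hv : IsPushforward Φ u v) (h : HasLogJacobian Φ ℓ)
    (hA : ∀ y, ‖(fderiv ℝ Φ y).inverse‖ ≤ A) (hB : ∀ y, ‖fderiv ℝ ℓ y‖ ≤ B)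
    (hC : ∀ y, |ℓ y| ≤ C) (hu : MemH1 u) : MemH1 v :=
  ⟨(memLp_congr_ae (hv.ae_eq_pushDensity h hC hu.1)).2 (h.memLp_pushDensity hC hu.1), _,
    hu.memLp_pushDensity_pullGrad h hA hB hC, hv.isWeakGradient h hA hB hC hu⟩

theorem dirichletEnergy_eq (hv : IsPushforward Φ u v) (h : HasLogJacobian Φ ℓ)
    (hA : ∀ y, ‖(fderiv ℝ Φ y).inverse‖ ≤ A) (hB : ∀ y, ‖fderiv ℝ ℓ y‖ ≤ B)
    (hC : ∀ y, |ℓ y| ≤ C) (hu : MemH1 u) :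
    dirichletEnergy v =
      ∫ y, 1 / 2 * (Real.exp (-ℓ y) * ‖pullGrad Φ ℓ u (weakGrad u) y‖ ^ 2) := by
  have weakGrad_ae_eq := (hv.isWeakGradient h hA hB hC hu).weakGrad_ae_eq
  have energy_eq : dirichletEnergy v =
      ∫ x, 1 / 2 * ‖pushDensity Φ ℓ (pullGrad Φ ℓ u (weakGrad u)) x‖ ^ 2 :=
    integral_congr_ae (weakGrad_ae_eq.mono fun _ hx => congrArg (fun k => 1 / 2 * ‖k‖ ^ 2) hx)
  rw [energy_eq, ← h.integral_exp_smul_comp]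
  simp only [pushDensity_apply, norm_smul, Real.norm_eq_abs, Real.abs_exp, smul_eq_mul]
  congr with y
  rw [Real.exp_neg]
  field_simp

end IsPushforward

end WeakGradient

end DirichletVariation

/-! ### The first variation -/

namespace DirichletVariation

open InnerProductSpace (toDual toDual_symm_apply)

section Inverse

variable {E : Type*} [NormedAddCommGroup E] [NormedSpace ℝ E] [CompleteSpace E]

theorem hasDerivAt_inverse_of_hasDerivAt_comp {A : ℝ → E →L[ℝ] E} {C : E →L[ℝ] E} {t : ℝ}
    (hA : HasDerivAt A (C ∘L A t) t) (ht : IsUnit (A t)) :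
    HasDerivAt (fun s => (A s).inverse) (-((A t).inverse ∘L C)) t := by
  obtain ⟨a, ha⟩ := ht
  have inverse_eq : (A t).inverse = ↑a⁻¹ := by
    rw [← ContinuousLinearMap.ringInverse_eq_inverse, ← ha, Ring.inverse_unit]
  have hasFDerivAt := hasFDerivAt_ringInverse (𝕜 := ℝ) a
  rw [ContinuousLinearMap.ringInverse_eq_inverse, ha] at hasFDerivAt
  refine (hasFDerivAt.comp_hasDerivAt t hA).congr_deriv ?_
  rw [inverse_eq, ← ha]
  change -(↑a⁻¹ * (C * ↑a) * ↑a⁻¹) = -(↑a⁻¹ * C)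
  rw [← mul_assoc, Units.mul_inv_cancel_right]

variable {ξ : E → E} {T : ℝ → E → E} {K M : NNReal}

namespace IsGlobalFlow

theorem fderiv_neg_comp_fderiv (hT : IsGlobalFlow ξ T) (hξ : ContDiff ℝ 1 ξ)
    (hK : LipschitzWith K ξ) (hM : LipschitzWith M (fderiv ℝ ξ)) (t : ℝ) (x : E) :
    fderiv ℝ (T (-t)) (T t x) ∘L fderiv ℝ (T t) x = .id ℝ E := by
  rw [← hT.fderiv_add hξ hK hM, neg_add_cancel, show T 0 = id from funext hT.1, fderiv_id]

theorem fderiv_comp_fderiv_neg (hT : IsGlobalFlow ξ T) (hξ : ContDiff ℝ 1 ξ)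
    (hK : LipschitzWith K ξ) (hM : LipschitzWith M (fderiv ℝ ξ)) (t : ℝ) (x : E) :
    fderiv ℝ (T t) x ∘L fderiv ℝ (T (-t)) (T t x) = .id ℝ E := by
  have h := hT.fderiv_neg_comp_fderiv hξ hK hM (-t) (T t x)
  rwa [neg_neg, ← hT.apply_add hK, neg_add_cancel, hT.1] at h

theorem inverse_fderiv (hT : IsGlobalFlow ξ T) (hξ : ContDiff ℝ 1 ξ) (hK : LipschitzWith K ξ)
    (hM : LipschitzWith M (fderiv ℝ ξ)) (t : ℝ) (x : E) :
    (fderiv ℝ (T t) x).inverse = fderiv ℝ (T (-t)) (T t x) :=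
  ContinuousLinearMap.inverse_eq (hT.fderiv_comp_fderiv_neg hξ hK hM t x)
    (hT.fderiv_neg_comp_fderiv hξ hK hM t x)

theorem fderiv_comp_inverse_fderiv (hT : IsGlobalFlow ξ T) (hξ : ContDiff ℝ 1 ξ)
    (hK : LipschitzWith K ξ) (hM : LipschitzWith M (fderiv ℝ ξ)) (t : ℝ) (x : E) :
    fderiv ℝ (T t) x ∘L (fderiv ℝ (T t) x).inverse = .id ℝ E := by
  rw [hT.inverse_fderiv hξ hK hM, hT.fderiv_comp_fderiv_neg hξ hK hM]

theorem norm_inverse_fderiv_le (hT : IsGlobalFlow ξ T) (hξ : ContDiff ℝ 1 ξ)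
    (hK : LipschitzWith K ξ) (hM : LipschitzWith M (fderiv ℝ ξ)) (t : ℝ) (x : E) :
    ‖(fderiv ℝ (T t) x).inverse‖ ≤ Real.exp (K * |t|) := by
  rw [hT.inverse_fderiv hξ hK hM, ← abs_neg t]
  exact hT.norm_fderiv_le hK (-t) (T t x)

theorem continuous_inverse_fderiv (hT : IsGlobalFlow ξ T) (hξ : ContDiff ℝ 1 ξ)
    (hK : LipschitzWith K ξ) (hM : LipschitzWith M (fderiv ℝ ξ)) (t : ℝ) :
    Continuous fun x => (fderiv ℝ (T t) x).inverse := by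
  simp only [hT.inverse_fderiv hξ hK hM]
  exact ((hT.contDiff hξ hK hM (-t)).continuous_fderiv one_ne_zero).comp
    (hT.lipschitzWith hK t).continuous

theorem hasDerivAt_inverse_fderiv (hT : IsGlobalFlow ξ T) (hξ : ContDiff ℝ 1 ξ)
    (hK : LipschitzWith K ξ) (hM : LipschitzWith M (fderiv ℝ ξ)) (t : ℝ) (x : E) :
    HasDerivAt (fun s => (fderiv ℝ (T s) x).inverse)
      (-((fderiv ℝ (T t) x).inverse ∘L fderiv ℝ ξ (T t x))) t :=
  hasDerivAt_inverse_of_hasDerivAt_comp (hT.hasDerivAt_fderiv hξ hK hM t x)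
    ⟨⟨_, _, hT.fderiv_comp_fderiv_neg hξ hK hM t x, hT.fderiv_neg_comp_fderiv hξ hK hM t x⟩, rfl⟩

end IsGlobalFlow

end Inverse

section FlowGradBound

variable {E : Type*} [NormedAddCommGroup E]

/-- A bound for `flowGrad T δ u g t`, uniform in `|t| ≤ 1`, when `T` is the flow of a
`K`-Lipschitz vector field and `δ` is `L`-Lipschitz. -/
noncomputable def flowGradBound (K L : NNReal) (u : E → ℝ) (g : E → E) (y : E) : ℝ :=
  (‖g y‖ + |u y| * (L * Real.exp K)) * Real.exp K

theorem memLp_flowGradBound [MeasurableSpace E] {μ : Measure E} {u : E → ℝ} {g : E → E}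
    {p : ENNReal} (K L : NNReal) (hu : MemLp u p μ) (hg : MemLp g p μ) :
    MemLp (flowGradBound K L u g) p μ :=
  (hg.norm.add (hu.norm.mul_const (L * Real.exp K))).mul_const (Real.exp K)

end FlowGradBound

section FlowGrad

variable {E : Type*} [NormedAddCommGroup E] [InnerProductSpace ℝ E]

/-- The first variation of the Dirichlet energy density along `ξ` at a point `x` where the
density has value `c` and gradient `p`; `δ` is the divergence of `ξ`. -/
noncomputable def variationDensity (ξ : E → E) (δ : E → ℝ) (x : E) (c : ℝ) (p : E) : ℝ :=
  -inner ℝ p (fderiv ℝ ξ x p) - 1 / 2 * ‖p‖ ^ 2 * δ x - c * fderiv ℝ δ x p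

theorem abs_variationDensity_le {ξ : E → E} {δ : E → ℝ} {K L : NNReal} {D : ℝ}
    (hK : LipschitzWith K ξ) (hL : LipschitzWith L δ) (hD : ∀ x, |δ x| ≤ D) (x : E) (c : ℝ)
    (p : E) : |variationDensity ξ δ x c p| ≤ (K + 1 / 2 * D) * ‖p‖ ^ 2 + L * (|c| * ‖p‖) := by
  have inner_le : |inner ℝ p (fderiv ℝ ξ x p)| ≤ ‖p‖ * (K * ‖p‖) :=
    (abs_real_inner_le_norm _ _).trans (by
      gcongr
      exact (fderiv ℝ ξ x).le_of_opNorm_le (norm_fderiv_le_of_lipschitz ℝ hK) p)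
  have divergence_le : |1 / 2 * ‖p‖ ^ 2 * δ x| ≤ 1 / 2 * ‖p‖ ^ 2 * D := by
    rw [abs_mul, abs_of_nonneg (by positivity : (0 : ℝ) ≤ 1 / 2 * ‖p‖ ^ 2)]
    gcongr
    exact hD x
  have fderiv_le : |c * fderiv ℝ δ x p| ≤ |c| * (L * ‖p‖) := by
    rw [abs_mul]
    gcongr
    exact (fderiv ℝ δ x).le_of_opNorm_le (norm_fderiv_le_of_lipschitz ℝ hL) p
  calc |variationDensity ξ δ x c p|
      ≤ |inner ℝ p (fderiv ℝ ξ x p)| + |1 / 2 * ‖p‖ ^ 2 * δ x| + |c * fderiv ℝ δ x p| := by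
        refine (abs_sub _ _).trans (add_le_add_left ((abs_sub _ _).trans_eq ?_) _)
        rw [abs_neg]
    _ ≤ (K + 1 / 2 * D) * ‖p‖ ^ 2 + L * (|c| * ‖p‖) := by linarith

section Measurability

variable [SecondCountableTopology E] [MeasurableSpace E] [OpensMeasurableSpace E] {μ : Measure E}
  {g : E → E}

theorem aestronglyMeasurable_fderiv_apply {F : Type*} [NormedAddCommGroup F] [NormedSpace ℝ F]
    {f : E → F} (hf : ContDiff ℝ 1 f) (hg : AEStronglyMeasurable g μ) :
    AEStronglyMeasurable (fun x => fderiv ℝ f x (g x)) μ :=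
  (ContinuousLinearMap.apply ℝ F).aestronglyMeasurable_comp₂ hg
    (hf.continuous_fderiv one_ne_zero).aestronglyMeasurable

theorem aestronglyMeasurable_variationDensity {ξ : E → E} {δ u : E → ℝ} (hξ : ContDiff ℝ 1 ξ)
    (hδ : ContDiff ℝ 1 δ) (hu : AEStronglyMeasurable u μ) (hg : AEStronglyMeasurable g μ) :
    AEStronglyMeasurable (fun x => variationDensity ξ δ x (u x) (g x)) μ :=
  ((hg.inner (aestronglyMeasurable_fderiv_apply hξ hg)).neg.sub
    (((hg.norm.pow 2).const_mul (1 / 2)).mul hδ.continuous.aestronglyMeasurable)).sub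
      (hu.mul (aestronglyMeasurable_fderiv_apply hδ hg))

end Measurability

variable [CompleteSpace E]

theorem inner_toDual_symm_eq_variationDensity_add (ξ : E → E) (δ : E → ℝ) (x : E) (c : ℝ)
    (p : E) :
    inner ℝ p ((toDual ℝ E).symm (-(c • fderiv ℝ δ x) - toDual ℝ E p ∘L fderiv ℝ ξ x)) =
      variationDensity ξ δ x c p + 1 / 2 * ‖p‖ ^ 2 * δ x := by
  rw [real_inner_comm, toDual_symm_apply, variationDensity]
  simp only [_root_.sub_apply, _root_.neg_apply, _root_.smul_apply, smul_eq_mul,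
    ContinuousLinearMap.comp_apply, InnerProductSpace.toDual_apply_apply]
  ring

/-- The gradient, at time `t` and in Lagrangian coordinates, of a density transported by the flow
`T` of a vector field with divergence `δ`; at time `0` the density is `u` and its gradient `g`. -/
noncomputable def flowGrad (T : ℝ → E → E) (δ u : E → ℝ) (g : E → E) (t : ℝ) : E → E :=
  pullGrad (T t) (trajectoryIntegral T δ t) u g

namespace IsGlobalFlow

variable {ξ : E → E} {T : ℝ → E → E} {K M L : NNReal} {δ u : E → ℝ} {g : E → E} {D : ℝ}

theorem flowGrad_zero (hT : IsGlobalFlow ξ T) : flowGrad T δ u g 0 = g := by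
  ext y
  rw [flowGrad, pullGrad, show T 0 = id from funext hT.1,
    show trajectoryIntegral T δ 0 = 0 from funext (trajectoryIntegral_zero T δ), fderiv_id,
    ContinuousLinearMap.inverse_id, fderiv_zero, Pi.zero_apply, smul_zero, sub_zero,
    ContinuousLinearMap.comp_id, LinearIsometryEquiv.symm_apply_apply]

theorem norm_flowGrad_le (hT : IsGlobalFlow ξ T) (hξ : ContDiff ℝ 1 ξ) (hK : LipschitzWith K ξ)
    (hM : LipschitzWith M (fderiv ℝ ξ)) (hδ : ContDiff ℝ 1 δ) (hL : LipschitzWith L δ) {t : ℝ}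
    (ht : |t| ≤ 1) (y : E) :
    ‖flowGrad T δ u g t y‖ ≤ flowGradBound K L u g y := by
  have exp_le : Real.exp (K * |t|) ≤ Real.exp K :=
    Real.exp_le_exp.2 (mul_le_of_le_one_right K.2 ht)
  have log_le : ‖fderiv ℝ (trajectoryIntegral T δ t) y‖ ≤ L * Real.exp K :=
    (hT.norm_fderiv_trajectoryIntegral_le hξ hK hM hδ hL t y).trans
      ((mul_le_of_le_one_right (by positivity) ht).trans (by gcongr))
  refine (norm_pullGrad_le _ _ u g y).trans ?_
  unfold flowGradBound
  gcongr
  exact (hT.norm_inverse_fderiv_le hξ hK hM t y).trans exp_le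

theorem hasDerivAt_flowGrad (hT : IsGlobalFlow ξ T) (hξ : ContDiff ℝ 1 ξ)
    (hK : LipschitzWith K ξ) (hM : LipschitzWith M (fderiv ℝ ξ)) (hδ : ContDiff ℝ 1 δ)
    (hL : LipschitzWith L δ) (t : ℝ) (y : E) :
    HasDerivAt (fun s => flowGrad T δ u g s y)
      ((toDual ℝ E).symm (-(u y • fderiv ℝ δ (T t y)) -
        toDual ℝ E (flowGrad T δ u g t y) ∘L fderiv ℝ ξ (T t y))) t := by
  have covector := (((hT.hasDerivAt_fderiv_trajectoryIntegral hξ hK hM hδ hL t y).const_smul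
    (u y)).const_sub (toDual ℝ E (g y))).clm_comp (hT.hasDerivAt_inverse_fderiv hξ hK hM t y)
  let riesz : StrongDual ℝ E ≃ₗᵢ[ℝ] E := (toDual ℝ E).symm
  refine (riesz.toContinuousLinearEquiv.toContinuousLinearMap.hasFDerivAt.comp_hasDerivAt t
    covector).congr_deriv ?_
  change (toDual ℝ E).symm _ = (toDual ℝ E).symm _
  congr 1
  rw [flowGrad, pullGrad, LinearIsometryEquiv.apply_symm_apply]
  ext v
  have cancel : fderiv ℝ (T t) y ((fderiv ℝ (T t) y).inverse v) = v :=
    DFunLike.congr_fun (hT.fderiv_comp_inverse_fderiv hξ hK hM t y) v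
  simp only [_root_.add_apply, _root_.sub_apply, _root_.neg_apply, _root_.smul_apply,
    Pi.smul_apply, ContinuousLinearMap.comp_apply, map_neg]
  rw [cancel]
  abel

theorem hasDerivAt_energyDensity (hT : IsGlobalFlow ξ T) (hξ : ContDiff ℝ 1 ξ)
    (hK : LipschitzWith K ξ) (hM : LipschitzWith M (fderiv ℝ ξ)) (hδ : ContDiff ℝ 1 δ)
    (hL : LipschitzWith L δ) (t : ℝ) (y : E) :
    HasDerivAt
      (fun s => 1 / 2 *
        (Real.exp (-trajectoryIntegral T δ s y) * ‖flowGrad T δ u g s y‖ ^ 2))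
      (Real.exp (-trajectoryIntegral T δ t y) *
        variationDensity ξ δ (T t y) (u y) (flowGrad T δ u g t y)) t := by
  refine (((hT.hasDerivAt_trajectoryIntegral hδ.continuous t y).neg.exp.mul
    (hT.hasDerivAt_flowGrad hξ hK hM hδ hL t y).norm_sq).const_mul (1 / 2)).congr_deriv ?_
  rw [inner_toDual_symm_eq_variationDensity_add]
  simp only [Pi.neg_apply]
  ring

theorem abs_variation_le (hT : IsGlobalFlow ξ T) (hξ : ContDiff ℝ 1 ξ) (hK : LipschitzWith K ξ)
    (hM : LipschitzWith M (fderiv ℝ ξ)) (hδ : ContDiff ℝ 1 δ) (hL : LipschitzWith L δ)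
    (hD : ∀ x, |δ x| ≤ D) {t : ℝ} (ht : |t| ≤ 1) (y : E) :
    |Real.exp (-trajectoryIntegral T δ t y) *
        variationDensity ξ δ (T t y) (u y) (flowGrad T δ u g t y)| ≤
      Real.exp D * ((K + 1 / 2 * D) * flowGradBound K L u g y ^ 2 +
        L * (|u y| * flowGradBound K L u g y)) := by
  have hD0 : 0 ≤ D := (abs_nonneg _).trans (hD y)
  have log_le : |trajectoryIntegral T δ t y| ≤ D :=
    (norm_trajectoryIntegral_le (f := δ) T hD t y).trans (mul_le_of_le_one_right hD0 ht)
  have grad_le := hT.norm_flowGrad_le (u := u) (g := g) hξ hK hM hδ hL ht y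
  rw [abs_mul, Real.abs_exp]
  gcongr
  · exact (neg_le_abs _).trans log_le
  · exact (abs_variationDensity_le hK hL hD _ _ _).trans (by gcongr)

theorem aestronglyMeasurable_energyDensity [SecondCountableTopology E] [MeasurableSpace E]
    [OpensMeasurableSpace E] {μ : Measure E} (hT : IsGlobalFlow ξ T) (hξ : ContDiff ℝ 1 ξ)
    (hK : LipschitzWith K ξ) (hM : LipschitzWith M (fderiv ℝ ξ)) (hδ : ContDiff ℝ 1 δ)
    (hL : LipschitzWith L δ) (hu : AEStronglyMeasurable u μ) (hg : AEStronglyMeasurable g μ)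
    (t : ℝ) :
    AEStronglyMeasurable (fun y => 1 / 2 *
      (Real.exp (-trajectoryIntegral T δ t y) * ‖flowGrad T δ u g t y‖ ^ 2)) μ := by
  have log := hT.contDiff_trajectoryIntegral hξ hK hM hδ hL t
  have grad : AEStronglyMeasurable (flowGrad T δ u g t) μ :=
    aestronglyMeasurable_pullGrad (hT.continuous_inverse_fderiv hξ hK hM t)
      (log.continuous_fderiv one_ne_zero) hu hg
  exact ((Real.continuous_exp.comp log.continuous.neg).aestronglyMeasurable.mul
    (grad.norm.pow 2)).const_mul (1 / 2)

theorem hasDerivAt_integral_energyDensity [SecondCountableTopology E] [MeasurableSpace E]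
    [OpensMeasurableSpace E] {μ : Measure E} (hT : IsGlobalFlow ξ T) (hξ : ContDiff ℝ 1 ξ)
    (hK : LipschitzWith K ξ) (hM : LipschitzWith M (fderiv ℝ ξ)) (hδ : ContDiff ℝ 1 δ)
    (hL : LipschitzWith L δ) (hD : ∀ x, |δ x| ≤ D) (hu : MemLp u 2 μ) (hg : MemLp g 2 μ) :
    Integrable (fun y => variationDensity ξ δ y (u y) (g y)) μ ∧
      HasDerivAt
        (fun t => ∫ y, 1 / 2 *
          (Real.exp (-trajectoryIntegral T δ t y) * ‖flowGrad T δ u g t y‖ ^ 2) ∂μ)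
        (∫ y, variationDensity ξ δ y (u y) (g y) ∂μ) 0 := by
  have hq : MemLp (flowGradBound K L u g) 2 μ := memLp_flowGradBound K L hu hg
  have variation_zero : (fun y => Real.exp (-trajectoryIntegral T δ 0 y) *
      variationDensity ξ δ (T 0 y) (u y) (flowGrad T δ u g 0 y)) =
        fun y => variationDensity ξ δ y (u y) (g y) := by
    simp only [trajectoryIntegral_zero, neg_zero, Real.exp_zero, one_mul, hT.1, hT.flowGrad_zero]
  rw [← variation_zero]
  refine hasDerivAt_integral_of_dominated_loc_of_deriv_le (Metric.ball_mem_nhds 0 one_pos)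
    (Filter.Eventually.of_forall fun t => ?_) ?_ ?_
    (Filter.Eventually.of_forall fun y t ht =>
      hT.abs_variation_le hξ hK hM hδ hL hD ?_ y)
    ?_
    (Filter.Eventually.of_forall fun y t _ => hT.hasDerivAt_energyDensity hξ hK hM hδ hL t y)
  · exact hT.aestronglyMeasurable_energyDensity hξ hK hM hδ hL hu.1 hg.1 t
  · simp only [trajectoryIntegral_zero, neg_zero, Real.exp_zero, one_mul, hT.flowGrad_zero]
    exact hg.norm.integrable_sq.const_mul (1 / 2)
  · rw [variation_zero]
    exact aestronglyMeasurable_variationDensity hξ hδ hu.1 hg.1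
  · rw [Metric.mem_ball, dist_zero_right] at ht
    exact ht.le
  · exact ((hq.integrable_sq.const_mul _).add
      ((hu.norm.integrable_mul hq).const_mul _)).const_mul _

end IsGlobalFlow

end FlowGrad

section Divergence

theorem IsGlobalFlow.hasLogJacobian {E : Type*} [NormedAddCommGroup E] [NormedSpace ℝ E]
    [FiniteDimensional ℝ E] {ξ : E → E} {T : ℝ → E → E} {K M L : NNReal} {δ : E → ℝ}
    (hT : IsGlobalFlow ξ T) (hξ : ContDiff ℝ 1 ξ) (hK : LipschitzWith K ξ)
    (hM : LipschitzWith M (fderiv ℝ ξ)) (hδ : ContDiff ℝ 1 δ) (hL : LipschitzWith L δ)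
    (hdiv : δ = fun x => LinearMap.trace ℝ E (fderiv ℝ ξ x)) (t : ℝ) :
    HasLogJacobian (hT.homeomorph hK t) (trajectoryIntegral T δ t) :=
  haveI := FiniteDimensional.complete ℝ E
  { contDiff := hT.contDiff hξ hK hM t
    contDiff_symm := hT.contDiff hξ hK hM (-t)
    contDiff_log := hT.contDiff_trajectoryIntegral hξ hK hM hδ hL t
    det_fderiv := hdiv ▸ hT.det_fderiv hξ hK hM t }

/-- The trace of a continuous endomorphism, as a continuous linear functional. -/
noncomputable def traceCLM (E : Type*) [NormedAddCommGroup E] [NormedSpace ℝ E]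
    [FiniteDimensional ℝ E] : (E →L[ℝ] E) →L[ℝ] ℝ :=
  (LinearMap.trace ℝ E ∘ₗ ContinuousLinearMap.coeLM ℝ).toContinuousLinearMap

variable {d : ℕ} {ξ : Space d → Space d} {K M : NNReal}

theorem divergence_eq_traceCLM_comp (ξ : Space d → Space d) :
    divergence ξ = traceCLM (Space d) ∘ fderiv ℝ ξ :=
  divergence_eq_trace ξ

theorem contDiff_divergence (hξ : ContDiff ℝ 2 ξ) : ContDiff ℝ 1 (divergence ξ) := by
  rw [divergence_eq_traceCLM_comp]
  exact (traceCLM (Space d)).contDiff.comp (hξ.fderiv_right (by norm_num))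

theorem lipschitzWith_divergence (hM : LipschitzWith M (fderiv ℝ ξ)) :
    LipschitzWith (‖traceCLM (Space d)‖₊ * M) (divergence ξ) := by
  rw [divergence_eq_traceCLM_comp]
  exact (traceCLM (Space d)).lipschitz.comp hM

theorem abs_divergence_le (hK : LipschitzWith K ξ) (x : Space d) :
    |divergence ξ x| ≤ ‖traceCLM (Space d)‖ * K := by
  rw [divergence_eq_traceCLM_comp]
  exact (traceCLM (Space d)).le_opNorm_of_le (norm_fderiv_le_of_lipschitz ℝ hK)

theorem variationIntegrand_eq (u : Space d → ℝ) (ξ : Space d → Space d) :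
    variationIntegrand u ξ =
      fun x => variationDensity ξ (divergence ξ) x (u x) (weakGrad u x) := by
  ext x
  rw [variationIntegrand, variationDensity, real_inner_comm (gradient _ x), gradient,
    toDual_symm_apply]

end Divergence

section Transport

variable {d : ℕ} {u v : Space d → ℝ} {ξ : Space d → Space d} {T : ℝ → Space d → Space d}
  {K M : NNReal}

namespace IsPushforward

theorem memH1_and_dirichletEnergy_eq_of_isGlobalFlow {t : ℝ} (hv : IsPushforward (T t) u v)
    (hT : IsGlobalFlow ξ T) (hξ : ContDiff ℝ 2 ξ) (hK : LipschitzWith K ξ)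
    (hM : LipschitzWith M (fderiv ℝ ξ)) (hu : MemH1 u) :
    MemH1 v ∧ dirichletEnergy v = ∫ y, 1 / 2 *
      (Real.exp (-trajectoryIntegral T (divergence ξ) t y) *
        ‖flowGrad T (divergence ξ) u (weakGrad u) t y‖ ^ 2) := by
  have hξ₁ : ContDiff ℝ 1 ξ := hξ.of_le (by norm_num)
  have hδ := contDiff_divergence hξ
  have hL := lipschitzWith_divergence hM
  have hΦ := hT.hasLogJacobian hξ₁ hK hM hδ hL (divergence_eq_trace ξ) t
  have hA := hT.norm_inverse_fderiv_le hξ₁ hK hM t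
  have hB := hT.norm_fderiv_trajectoryIntegral_le hξ₁ hK hM hδ hL t
  have hC := norm_trajectoryIntegral_le (f := divergence ξ) T (abs_divergence_le hK) t
  exact ⟨memH1 (Φ := hT.homeomorph hK t) hv hΦ hA hB hC hu,
    dirichletEnergy_eq (Φ := hT.homeomorph hK t) hv hΦ hA hB hC hu⟩

end IsPushforward

end Transport

end DirichletVariation

theorem mainTheorem4_general {d : ℕ} {u₀ : DirichletVariation.Space d → ℝ}
    (hu₀ : DirichletVariation.MemH1 u₀)
    {ξ : DirichletVariation.Space d → DirichletVariation.Space d} {K M : NNReal}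
    (hξ : ContDiff ℝ 2 ξ) (hK : LipschitzWith K ξ) (hM : LipschitzWith M (fderiv ℝ ξ))
    {T : ℝ → DirichletVariation.Space d → DirichletVariation.Space d}
    (hT : DirichletVariation.IsFlow ξ T) {u : ℝ → DirichletVariation.Space d → ℝ}
    (hu : ∀ t, DirichletVariation.IsPushforward (T t) u₀ (u t)) :
    (∀ t, DirichletVariation.MemH1 (u t)) ∧
    Integrable (DirichletVariation.variationIntegrand u₀ ξ) ∧
    HasDerivAt (fun t => DirichletVariation.dirichletEnergy (u t))
      (∫ x, DirichletVariation.variationIntegrand u₀ ξ x) 0 := by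
  have transport := fun t =>
    (hu t).memH1_and_dirichletEnergy_eq_of_isGlobalFlow hT hξ hK hM hu₀
  refine ⟨fun t => (transport t).1, ?_⟩
  simp only [fun t => (transport t).2, DirichletVariation.variationIntegrand_eq]
  exact DirichletVariation.IsGlobalFlow.hasDerivAt_integral_energyDensity hT
    (hξ.of_le (by norm_num)) hK hM (DirichletVariation.contDiff_divergence hξ)
    (DirichletVariation.lipschitzWith_divergence hM) (DirichletVariation.abs_divergence_le hK)
    hu₀.1 hu₀.memLp_weakGrad

theorem mainTheorem4 (d : ℕ)
    (u₀ : DirichletVariation.Space d → ℝ) (hu₀ : DirichletVariation.MemH1 u₀)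
    (ξ : DirichletVariation.Space d → DirichletVariation.Space d)
    (hξ : ContDiff ℝ ∞ ξ) (hξc : HasCompactSupport ξ)
    (T : ℝ → DirichletVariation.Space d → DirichletVariation.Space d)
    (hT : DirichletVariation.IsFlow ξ T)
    (u : ℝ → DirichletVariation.Space d → ℝ)
    (hu : ∀ t, DirichletVariation.IsPushforward (T t) u₀ (u t)) :
    (∀ t, DirichletVariation.MemH1 (u t)) ∧
    Integrable (DirichletVariation.variationIntegrand u₀ ξ) ∧
    HasDerivAt (fun t => DirichletVariation.dirichletEnergy (u t))
      (∫ x, DirichletVariation.variationIntegrand u₀ ξ x) 0 := by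
  obtain ⟨_, hK⟩ := hξ.lipschitzWith_of_hasCompactSupport hξc (by simp)
  obtain ⟨_, hM⟩ := (hξ.fderiv_right (m := ∞) le_rfl).lipschitzWith_of_hasCompactSupport
    (hξc.fderiv ℝ) (by simp)
  exact mainTheorem4_general hu₀ (contDiff_infty.1 hξ 2) hK hM hT hu
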